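/- Let $\mathcal T=[0,1]^d$ and let $\langle\cdot,\cdot\rangle_2,\|\cdot\|_2$ be the inner product and norm of $L^2(\mathcal T)$. Let $Y=\langle\beta^*,X\rangle_2+\varepsilon$, where $\beta^*\in L^2(\mathcal T)$, $X$ is a random function with $\mathbb E[X]=0$, $\|X\|_2=1$ almost surely and continuous covariance function $C(u,v)=\mathbb E[X(u)X(v)]$, $C\not\equiv0$, and the noise $\varepsilon$ has finite variance $\sigma^2$ and satisfies $\mathbb E[\varepsilon\mid X]=0$ and $\mathbb E[\varepsilon^2\mid X]=\sigma^2$ (for instance, $\varepsilon$ is centered with variance $\sigma^2$ and independent of $X$). Let $K\not\equiv0$ be a continuous, symmetric, positive semi-definite kernel on $\mathcal T$, and $\kappa=\max_{u}\sqrt{K(u,u)}$. Let $L_K,L_C$ be the integral operators on $L^2(\mathcal T)$ with kernels $K$ and $C$, and put $\mathscr L_K=L_C^{1/2}L_KL_C^{1/2}$. Powers of compact positive semi-definite operators are defined by the spectral theorem, and $\mathrm{Tr}$ is the sum of the positive eigenvalues with multiplicity. Let $r>0$ and $0<s\le1$, and assume: 1. $L_C^{1/2}\beta^*=\mathscr L_K^{r}g^*$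 for some $g^*\in L^2(\mathcal T)$; 2. $\mathrm{Tr}(\mathscr L_K^{s})<\infty$; 3. there is $c_{\mathsf M}>0$ such that $\mathbb E[\langle X,f\rangle_2^4]\le c_{\mathsf M}\big(\mathbb E[\langle X,f\rangle_2^2]\big)^2$ for all $f\in L^2(\mathcal T)$. For a linear functional $\varphi$ on $L^2(\mathcal T)$ put $\mathcal E(\varphi)=\mathbb E\big[(Y-\varphi(X))^2-(Y-\langle\beta^*,X\rangle_2)^2\big]$. Given $T\ge1$ and independent copies $(x_1,y_1),\dots,(x_T,y_T)$ of $(X,Y)$, let $\hat\beta_1=0$, $$\hat\beta_{t+1}=\hat\beta_t-\eta\,\big(\langle\hat\beta_t,x_t\rangle_2-y_t\big)\int_{\mathcal T}K(v,\cdot)\,x_t(v)\,dv\quad(1\le t\le T),\qquad \eta=\eta_0T^{-2r/(2r+1)},$$ and $\hat\varphi_{T+1}=\langle\hat\beta_{T+1},\cdot\rangle_2$. Then there is a constant $C^{\mathsf S}>0$, depending only on $r,s,\kappa,c_{\mathsf M}$ and $\mathrm{Tr}(\mathscr L_K^s)$ (and not on $T$), such that for every $\eta_0$ with $0<\eta_0\le\min\{1,\kappa^{-2},C^{\mathsf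 S}\}$ there is a constant $C_2$, depending only on the same quantities and on $\eta_0,\|\beta^*\|_2,\|g^*\|_2,\sigma^2$ (and not on $T$), such that for all $T\ge1$ the random variable $\mathcal E(\hat\varphi_{T+1})$ is integrable and $$\mathbb E[\mathcal E(\hat\varphi_{T+1})]\le C_2\begin{cases}T^{-2r/(2r+1)},&0<s<1,\\ T^{-2r/(2r+1)}\log(T+1),&s=1.\end{cases}$$ Here $r>0$ is arbitrary, so the rate does not saturate in $r$. -/

import Mathlib

open MeasureTheory ProbabilityTheory
open scoped ENNReal

noncomputable section

namespace FunctionalSGD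

/-- The cube `[0,1]^d`, with its Lebesgue (probability) measure `volume`. -/
abbrev Cube (d : ℕ) : Type := Fin d → unitInterval

/-- The real Hilbert space `L²([0,1]^d)`. -/
abbrev L2 (d : ℕ) : Type := Lp ℝ 2 (volume : Measure (Cube d))

/-- `L²([0,1]^d)` carries its Borel σ-algebra. -/
instance instMeasurableSpaceL2 (d : ℕ) : MeasurableSpace (L2 d) := borel _

instance instBorelSpaceL2 (d : ℕ) : BorelSpace (L2 d) := ⟨rfl⟩

/-- The class in `L²` of a square integrable function (and `0` for any other function). -/
def toL2 {d : ℕ} (f : Cube d → ℝ) : L2 d :=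
  open Classical in if h : MemLp f 2 volume then h.toLp f else 0

/-! ### Integral operators with continuous kernels -/

theorem integral_kernel_eq_inner {d : ℕ} (K : C(Cube d × Cube d, ℝ)) (f : L2 d) (u : Cube d) :
    ∫ v, K (u, v) * f v = inner ℝ (ContinuousMap.toLp 2 volume ℝ (K.curry u)) f := by
  rw [L2.inner_def]
  refine integral_congr_ae ?_
  filter_upwards [ContinuousMap.coeFn_toLp (p := 2) (𝕜 := ℝ) volume (K.curry u)] with v hv
  simp only [hv, RCLike.inner_apply, conj_trivial]
  exact mul_comm _ _

/-- The continuous function `u ↦ ∫ K(u, v) f(v) dv`. -/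
def integralFun {d : ℕ} (K : C(Cube d × Cube d, ℝ)) (f : L2 d) : C(Cube d, ℝ) where
  toFun u := ∫ v, K (u, v) * f v
  continuous_toFun := by
    simp only [integral_kernel_eq_inner]
    exact (((ContinuousMap.toLp 2 volume ℝ).continuous.comp K.curry.continuous).inner
      continuous_const)

/-- The integral operator `L_K f = ∫ K(·, v) f(v) dv` on `L²([0,1]^d)`. -/
def integralOp {d : ℕ} (K : C(Cube d × Cube d, ℝ)) : L2 d →L[ℝ] L2 d :=
  (ContinuousMap.toLp 2 volume ℝ).comp <|
    LinearMap.mkContinuous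
      { toFun := integralFun K
        map_add' := fun f g => by
          ext u
          change ∫ v, K (u, v) * (f + g : L2 d) v
            = (∫ v, K (u, v) * f v) + ∫ v, K (u, v) * g v
          simp only [integral_kernel_eq_inner, inner_add_right]
        map_smul' := fun (c : ℝ) (f : L2 d) => by
          ext u
          rw [RingHom.id_apply, ContinuousMap.smul_apply, smul_eq_mul]
          change ∫ v, K (u, v) * (c • f : L2 d) v = c * ∫ v, K (u, v) * f v
          simp only [integral_kernel_eq_inner, inner_smul_right] }
      (‖(ContinuousMap.toLp 2 volume ℝ : C(Cube d, ℝ) →L[ℝ] L2 d)‖ * ‖K.curry‖)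
      (fun f => by
        rw [ContinuousMap.norm_le _ (by positivity)]
        intro u
        change ‖∫ v, K (u, v) * f v‖ ≤ _
        rw [integral_kernel_eq_inner]
        refine (norm_inner_le_norm _ _).trans ?_
        gcongr
        refine (ContinuousLinearMap.le_opNorm _ _).trans ?_
        gcongr
        exact K.curry.norm_coe_le_norm u)

theorem integralOp_apply {d : ℕ} (K : C(Cube d × Cube d, ℝ)) (f : L2 d) :
    integralOp K f = ContinuousMap.toLp 2 volume ℝ (integralFun K f) := rfl

theorem integralOp_apply_ae {d : ℕ} (K : C(Cube d × Cube d, ℝ)) (f : L2 d) :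
    integralOp K f =ᵐ[volume] fun u => ∫ v, K (u, v) * f v := by
  rw [integralOp_apply]
  exact ContinuousMap.coeFn_toLp (p := 2) (𝕜 := ℝ) volume (integralFun K f)

/-! ### Functional calculus and trace of compact positive semi-definite operators -/

section Operators

variable {H : Type*} [NormedAddCommGroup H] [InnerProductSpace ℝ H] [CompleteSpace H]

/-- The eigenspace `{f | A f = μ f}`. -/
def eigenspace (A : H →L[ℝ] H) (μ : ℝ) : Submodule ℝ H :=
  (A - μ • ContinuousLinearMap.id ℝ H).ker

instance instCompleteSpaceEigenspace (A : H →L[ℝ] H) (μ : ℝ) : CompleteSpace (eigenspace A μ) :=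
  inferInstanceAs (CompleteSpace (A - μ • ContinuousLinearMap.id ℝ H).ker)

/-- The power `A ^ p = ∑_{μ > 0} μ ^ p P_μ`, `p > 0`, of a compact positive semi-definite operator,
where `P_μ` is the orthogonal projection onto the eigenspace of `μ` (so that `P_μ = 0` if `μ` is
not an eigenvalue); the sum converges in the operator norm. -/
def opPow (A : H →L[ℝ] H) (p : ℝ) : H →L[ℝ] H :=
  ∑' μ : {μ : ℝ // 0 < μ}, (μ : ℝ) ^ p • (eigenspace A (μ : ℝ)).starProjection

/-- The trace of a compact positive semi-definite operator: the sum of all its positive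
eigenvalues, counted with multiplicity. -/
def opTrace (A : H →L[ℝ] H) : ℝ≥0∞ :=
  ∑' μ : {μ : ℝ // 0 < μ},
    ENNReal.ofReal (μ : ℝ) * ((Cardinal.toENat (Module.rank ℝ (eigenspace A (μ : ℝ))) : ℕ∞) : ℝ≥0∞)

end Operators

/-! ### Kernels -/

/-- A (continuous) reproducing kernel: symmetric with positive semi-definite Gram matrices. -/
structure IsReproducingKernel {d : ℕ} (K : C(Cube d × Cube d, ℝ)) : Prop where
  symm : ∀ u v, K (u, v) = K (v, u)
  posSemidef : ∀ (n : ℕ) (u : Fin n → Cube d),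
    (Matrix.of fun i j => K (u i, u j)).PosSemidef

/-- `κ = max_u √K(u,u)`. -/
def kappa {d : ℕ} (K : C(Cube d × Cube d, ℝ)) : ℝ := ⨆ u : Cube d, √(K (u, u))

/-- The operator `𝓛_K = L_C^{1/2} L_K L_C^{1/2}`. -/
def scrL {d : ℕ} (C K : C(Cube d × Cube d, ℝ)) : L2 d →L[ℝ] L2 d :=
  (opPow (integralOp C) (1 / 2)).comp
    ((integralOp K).comp (opPow (integralOp C) (1 / 2)))

/-! ### The functional linear model -/

/-- The functional linear model `Y = ⟨β*, X⟩ + ε` on a probability space `(Ω, P)`: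
`X` is a (jointly measurable) centered random function with `‖X‖₂ = 1` almost surely and with a
continuous covariance function `C ≢ 0`, `β* ∈ L²`, and `ε` is a noise with finite variance which,
given `X`, is centered with constant variance. -/
structure FLModel (d : ℕ) {Ω : Type*} [MeasurableSpace Ω] (P : Measure Ω) where
  /-- the random function -/
  X : Ω → Cube d → ℝ
  /-- the slope function -/
  betaStar : L2 d
  /-- the noise -/
  noise : Ω → ℝ
  /-- the covariance function, as a continuous function on `[0,1]^d × [0,1]^d` -/
  C : C(Cube d × Cube d, ℝ)
  measurable_X : Measurable (Function.uncurry X)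
  memLp_X : ∀ u, MemLp (fun ω => X ω u) 2 P
  mean_X : ∀ u, ∫ ω, X ω u ∂P = 0
  norm_X : ∀ᵐ ω ∂P, ‖toL2 (X ω)‖ = 1
  cov_X : ∀ u v, C (u, v) = ∫ ω, X ω u * X ω v ∂P
  C_ne_zero : C ≠ 0
  memLp_noise : MemLp noise 2 P
  noise_mean : P[noise | MeasurableSpace.comap (fun ω => toL2 (X ω)) inferInstance] =ᵐ[P] 0
  noise_var : P[fun ω => noise ω ^ 2 | MeasurableSpace.comap (fun ω => toL2 (X ω)) inferInstance]
    =ᵐ[P] fun _ => Var[noise; P]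

namespace FLModel

variable {d : ℕ} {Ω : Type*} [MeasurableSpace Ω] {P : Measure Ω} (M : FLModel d P)

/-- The random function `X` as a random element of `L²`. -/
def XL (ω : Ω) : L2 d := toL2 (M.X ω)

/-- The response `Y = ⟨β*, X⟩ + ε`. -/
def Y (ω : Ω) : ℝ := inner ℝ M.betaStar (M.XL ω) + M.noise ω

/-- The excess generalization error `𝓔(φ) = E[(Y - φ(X))² - (Y - φ*(X))²]`, `φ* = ⟨β*, ·⟩`. -/
def excessError (φ : L2 d → ℝ) : ℝ :=
  ∫ ω, ((M.Y ω - φ (M.XL ω)) ^ 2 - (M.Y ω - inner ℝ M.betaStar (M.XL ω)) ^ 2) ∂P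

/-- The samples `(x_1, y_1), …, (x_T, y_T)`, defined on a probability space `(Ω', Q)`, are
independent copies of `(X, Y)`. -/
structure IsSample {Ω' : Type*} [MeasurableSpace Ω'] (Q : Measure Ω') (T : ℕ)
    (x : ℕ → Ω' → L2 d) (y : ℕ → Ω' → ℝ) : Prop where
  identDistrib : ∀ t ∈ Finset.Icc 1 T,
    IdentDistrib (fun ω' => (x t ω', y t ω')) (fun ω => (M.XL ω, M.Y ω)) Q P
  indep : iIndepFun (fun (t : Finset.Icc 1 T) ω' => (x t ω', y t ω')) Q

end FLModel

/-- Stochastic gradient descent: `sgd K η x y t` is `β̂_{t+1}`, the estimator obtained after `t`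
steps, where `β̂_1 = 0` and `β̂_{t+1} = β̂_t - η_t (⟨β̂_t, x_t⟩ - y_t) ∫ K(·, v) x_t(v) dv`. -/
def sgd {d : ℕ} (K : C(Cube d × Cube d, ℝ)) (η : ℕ → ℝ) (x : ℕ → L2 d) (y : ℕ → ℝ) :
    ℕ → L2 d
  | 0 => 0
  | t + 1 => sgd K η x y t
      - (η (t + 1) * (inner ℝ (sgd K η x y t) (x (t + 1)) - y (t + 1))) •
        integralOp K (x (t + 1))

end FunctionalSGD

end

/-! Write S = L_C^{1/2}, Z = 1 - η S L_K S, and e_n for the estimator after n steps minus β*. The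
excess error of ⟨β, ·⟩ is ‖S(β - β*)‖² (`excessError_inner`), so only second moments of S e_n
matter. The next observation is independent of e_n and the noise is centered given X, so for every
bounded operator B E‖B S e_{n+1}‖² ≤ E‖B Z S e_n‖² + η² (cM E‖S e_n‖² + σ²) E‖B S L_K X‖²; the
fourth-moment condition is what separates ⟨X, e⟩² from ‖B S L_K X‖². Absorbing Z into B and
iterating (`IsSample.integral_norm_sq_le`) leaves a squared bias ‖Z^n S β*‖² and a variance η² (cM D
+ σ²) ∑_j E‖Z^j S L_K X‖², where D bounds the earlier risks.

Bias: S β* = (S L_K S)^r g*, and z^r (1 - z)^n ≤ (r/n)^r on (0, 1], so the bias is at most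
(r/(ηn))^r ‖g*‖ for every r > 0; this is why the rate does not saturate
(`norm_one_sub_pow_opPow_le`).

Variance: along p ↦ p - η S² L_K p the energy ⟨L_K p, p⟩ loses at least η‖S L_K p‖² per step and
stays nonnegative. Hence η ∑_j ‖Z^j S L_K x‖² ≤ ⟨L_K x, x⟩ ≤ κ² when ‖x‖ = 1, uniformly in the
number of terms, and the variance is O(η) (`sum_norm_sq_one_sub_pow_le`).

The bound D propagates by induction once η κ² cM ≤ 1/2. For η = η₀ T^{-2r/(2r+1)} squared bias and
variance both have order T^{-2r/(2r+1)}. -/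

namespace FunctionalSGD

/-! ### Spectral calculus for compact symmetric operators, and the bias bound. -/

section Spectral

variable {H : Type*} [NormedAddCommGroup H] [InnerProductSpace ℝ H]

/-- Pythagoras followed by Bessel. The coefficients are controlled only where `V i ≠ ⊥`, because the
index set will be all positive reals while only eigenvalues contribute. -/
theorem norm_sum_smul_starProjection_le {ι : Type*} (V : ι → Submodule ℝ H)
    [∀ i, (V i).HasOrthogonalProjection]
    (hV : OrthogonalFamily ℝ (fun i => V i) fun i => (V i).subtypeₗᵢ) (c : ι → ℝ) {m : ℝ}
    (hm : 0 ≤ m) (t : Finset ι) (hc : ∀ i ∈ t, V i ≠ ⊥ → |c i| ≤ m) (x : H) :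
    ‖∑ i ∈ t, c i • (V i).starProjection x‖ ≤ m * ‖x‖ := by
  have key : ∀ c : ι → ℝ, ‖∑ i ∈ t, c i • (V i).starProjection x‖ ^ 2
      = ∑ i ∈ t, c i ^ 2 * ‖(V i).starProjection x‖ ^ 2 := by
    intro c
    have h := hV.norm_sum
      (fun i => ⟨c i • (V i).starProjection x,
        (V i).smul_mem _ ((V i).starProjection_apply_mem x)⟩) t
    simp only [Submodule.coe_subtypeₗᵢ, Submodule.subtype_apply, Submodule.coe_norm, norm_smul,
      mul_pow, Real.norm_eq_abs, sq_abs] at h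
    exact h
  have bessel : ∑ i ∈ t, ‖(V i).starProjection x‖ ^ 2 ≤ ‖x‖ ^ 2 := by
    set y := ∑ i ∈ t, (V i).starProjection x with hy
    have h1 : ‖y‖ ^ 2 = ∑ i ∈ t, ‖(V i).starProjection x‖ ^ 2 := by
      have := key fun _ => 1
      simpa using this
    have h2 : inner ℝ y x = ‖y‖ ^ 2 := by
      rw [h1, hy, sum_inner]
      exact Finset.sum_congr rfl fun i _ => by
        simpa using (V i).re_inner_starProjection_eq_normSq x
    rw [← h1]
    have h3 := real_inner_le_norm y x
    have h4 : ‖y‖ ≤ ‖x‖ := by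
      by_contra! h
      nlinarith [norm_nonneg y, norm_nonneg x]
    gcongr
  refine abs_le_of_sq_le_sq' ?_ (by positivity) |>.2
  rw [key, mul_pow]
  calc ∑ i ∈ t, c i ^ 2 * ‖(V i).starProjection x‖ ^ 2
      ≤ ∑ i ∈ t, m ^ 2 * ‖(V i).starProjection x‖ ^ 2 := by
        refine Finset.sum_le_sum fun i hi => ?_
        by_cases hb : V i = ⊥
        · have hmem := (V i).starProjection_apply_mem x
          have h0 : (V i).starProjection x = 0 := (Submodule.eq_bot_iff _).1 hb _ hmem
          simp [h0]
        · refine mul_le_mul_of_nonneg_right ?_ (sq_nonneg _)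
          rw [← sq_abs]
          exact pow_le_pow_left₀ (abs_nonneg _) (hc i hi hb) 2
    _ ≤ m ^ 2 * ‖x‖ ^ 2 := by
        rw [← Finset.mul_sum]
        gcongr

theorem mem_eigenspace {A : H →L[ℝ] H} {μ : ℝ} {f : H} : f ∈ eigenspace A μ ↔ A f = μ • f := by
  simp [eigenspace, sub_eq_zero]

theorem eigenspace_eq_moduleEnd (A : H →L[ℝ] H) (μ : ℝ) :
    eigenspace A μ = Module.End.eigenspace (A : H →ₗ[ℝ] H) μ := by
  ext f
  simp [mem_eigenspace]

theorem orthogonalFamily_eigenspace {A : H →L[ℝ] H} (hA : (A : H →ₗ[ℝ] H).IsSymmetric) :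
    OrthogonalFamily ℝ (fun μ => eigenspace A μ) fun μ => (eigenspace A μ).subtypeₗᵢ := by
  have h := hA.orthogonalFamily_eigenspaces
  intro μ ν hμν f g
  exact h hμν ⟨f, by rw [← eigenspace_eq_moduleEnd]; exact f.2⟩
    ⟨g, by rw [← eigenspace_eq_moduleEnd]; exact g.2⟩

theorem orthogonalFamily_pos_eigenspace {A : H →L[ℝ] H}
    (hA : (A : H →ₗ[ℝ] H).IsSymmetric) :
    OrthogonalFamily ℝ (fun μ : {μ : ℝ // 0 < μ} => eigenspace A μ)
      fun μ => (eigenspace A (μ : ℝ)).subtypeₗᵢ :=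
  (orthogonalFamily_eigenspace hA).comp Subtype.val_injective

/-- A compact symmetric operator has finitely many eigenvalues away from zero. -/
theorem finite_setOf_le_eigenvalue {A : H →L[ℝ] H} (hc : IsCompactOperator A)
    (hA : (A : H →ₗ[ℝ] H).IsSymmetric) {ε : ℝ} (hε : 0 < ε) :
    {μ : ℝ | ε ≤ μ ∧ eigenspace A μ ≠ ⊥}.Finite := by
  by_contra hinf
  have hinf : {μ : ℝ | ε ≤ μ ∧ eigenspace A μ ≠ ⊥}.Infinite := hinf
  -- Infinitely many such eigenvalues would give orthonormal eigenvectors whose images are at mutual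
  -- distance at least ε, so no subsequence of the images could converge.
  let ν := hinf.natEmbedding
  have hex : ∀ n, ∃ f : H, f ∈ eigenspace A (ν n : ℝ) ∧ ‖f‖ = 1 := by
    intro n
    obtain ⟨f, hf, hf0⟩ := (Submodule.ne_bot_iff _).1 (ν n).2.2
    exact ⟨‖f‖⁻¹ • f, Submodule.smul_mem _ _ hf, norm_smul_inv_norm hf0⟩
  choose e he he1 using hex
  obtain ⟨S, hS, hSA⟩ := hc.image_closedBall_subset_compact (f := (A : H →ₗ[ℝ] H)) 1
  have hmem : ∀ n, A (e n) ∈ S := fun n => hSA ⟨e n, by simp [he1], rfl⟩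
  obtain ⟨a, -, φ, hφ, hlim⟩ := hS.tendsto_subseq hmem
  obtain ⟨N, hN⟩ := Metric.cauchySeq_iff.1 hlim.cauchySeq ε hε
  have hlt := hN (N + 1) (by simp) N le_rfl
  have hne : φ (N + 1) ≠ φ N := (hφ (Nat.lt_succ_self N)).ne'
  set i := φ (N + 1)
  set j := φ N
  have hne' : (ν i : ℝ) ≠ ν j := fun h => hne (ν.injective (Subtype.ext h))
  have horth : inner ℝ (e i) (e j) = 0 :=
    orthogonalFamily_eigenspace hA hne' ⟨e i, he i⟩ ⟨e j, he j⟩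
  have hi := mem_eigenspace.1 (he i)
  have hj := mem_eigenspace.1 (he j)
  change dist (A (e i)) (A (e j)) < ε at hlt
  rw [dist_eq_norm, hi, hj] at hlt
  have hsq : ‖(ν i : ℝ) • e i - (ν j : ℝ) • e j‖ ^ 2 = (ν i : ℝ) ^ 2 + (ν j : ℝ) ^ 2 := by
    rw [norm_sub_sq_real, inner_smul_left, inner_smul_right, horth, norm_smul, norm_smul, he1, he1]
    simp
  have h1 : ε ≤ ν i := (ν i).2.1
  have h2 : ‖(ν i : ℝ) • e i - (ν j : ℝ) • e j‖ ^ 2 < ε ^ 2 :=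
    pow_lt_pow_left₀ hlt (norm_nonneg _) two_ne_zero
  nlinarith [sq_nonneg (ν j : ℝ)]

variable [CompleteSpace H]

/-- Only finitely many eigenvalues are at least δ, and any finite sum avoiding them has norm at most
δ^p. The choice δ = (ε/2)^{1/p} makes this ε/2. -/
theorem summable_opPow {A : H →L[ℝ] H} (hc : IsCompactOperator A)
    (hA : (A : H →ₗ[ℝ] H).IsSymmetric) {p : ℝ} (hp : 0 < p) :
    Summable fun μ : {μ : ℝ // 0 < μ} => (μ : ℝ) ^ p • (eigenspace A (μ : ℝ)).starProjection := by
  rw [summable_iff_vanishing_norm]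
  intro ε hε
  set δ : ℝ := (ε / 2) ^ p⁻¹ with hδ
  have hδ0 : 0 < δ := by positivity
  have hfin : {μ : {μ : ℝ // 0 < μ} | δ ≤ (μ : ℝ) ∧ eigenspace A (μ : ℝ) ≠ ⊥}.Finite :=
    (finite_setOf_le_eigenvalue hc hA hδ0).preimage Subtype.val_injective.injOn
  refine ⟨hfin.toFinset, fun t ht => ?_⟩
  refine lt_of_le_of_lt ?_ (half_lt_self hε)
  refine ContinuousLinearMap.opNorm_le_bound _ (by positivity) fun x => ?_
  simp only [sum_apply, smul_apply]
  refine norm_sum_smul_starProjection_le _ (orthogonalFamily_pos_eigenspace hA)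
    (fun μ : {μ : ℝ // 0 < μ} => (μ : ℝ) ^ p) (by positivity) t (fun μ hμ hb => ?_) x
  have hlt : (μ : ℝ) < δ := by
    by_contra! h
    exact Finset.disjoint_left.1 ht hμ (hfin.mem_toFinset.2 ⟨h, hb⟩)
  rw [abs_of_nonneg (Real.rpow_nonneg μ.2.le _)]
  calc (μ : ℝ) ^ p ≤ δ ^ p := Real.rpow_le_rpow μ.2.le hlt.le hp.le
    _ = ε / 2 := by rw [hδ, Real.rpow_inv_rpow (by positivity) hp.ne']

theorem hasSum_opPow_apply {A : H →L[ℝ] H} (hc : IsCompactOperator A)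
    (hA : (A : H →ₗ[ℝ] H).IsSymmetric) {p : ℝ} (hp : 0 < p) (f : H) :
    HasSum (fun μ : {μ : ℝ // 0 < μ} =>
      (μ : ℝ) ^ p • (eigenspace A (μ : ℝ)).starProjection f) (opPow A p f) := by
  have h := (summable_opPow hc hA hp).hasSum
  exact h.mapL (ContinuousLinearMap.apply ℝ H f)

theorem opPow_isSymmetric {A : H →L[ℝ] H} (hc : IsCompactOperator A)
    (hA : (A : H →ₗ[ℝ] H).IsSymmetric) {p : ℝ} (hp : 0 < p) (f g : H) :
    inner ℝ (opPow A p f) g = inner ℝ f (opPow A p g) := by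
  have h1 := (hasSum_opPow_apply hc hA hp f).mapL (innerSL ℝ g)
  have h2 := (hasSum_opPow_apply hc hA hp g).mapL (innerSL ℝ f)
  simp only [innerSL_apply_apply] at h1 h2
  rw [real_inner_comm]
  refine h1.unique ?_
  convert! h2 using 2 with μ
  rw [inner_smul_right, inner_smul_right, ← Submodule.inner_starProjection_left_eq_right,
    real_inner_comm]

theorem opPow_apply_of_mem_eigenspace {A : H →L[ℝ] H} (hc : IsCompactOperator A)
    (hA : (A : H →ₗ[ℝ] H).IsSymmetric) {p : ℝ} (hp : 0 < p) {μ : ℝ} (hμ : 0 ≤ μ) {f : H}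
    (hf : f ∈ eigenspace A μ) : opPow A p f = μ ^ p • f := by
  have h := hasSum_opPow_apply hc hA hp f
  have h0 : ∀ ν : {μ : ℝ // 0 < μ}, (ν : ℝ) ≠ μ → (eigenspace A (ν : ℝ)).starProjection f = 0 := by
    intro ν hν
    rw [Submodule.starProjection_apply_eq_zero_iff, Submodule.mem_orthogonal]
    intro g hg
    exact orthogonalFamily_eigenspace hA hν ⟨g, hg⟩ ⟨f, hf⟩
  rcases hμ.eq_or_lt with rfl | hμ
  · rw [Real.zero_rpow hp.ne', zero_smul]
    refine h.unique ?_
    convert! (hasSum_zero : HasSum (fun _ : {μ : ℝ // 0 < μ} => (0 : H)) 0) using 2 with ν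
    rw [h0 ν ν.2.ne', smul_zero]
  · have h1 := hasSum_single (f := fun ν : {μ : ℝ // 0 < μ} =>
      (ν : ℝ) ^ p • (eigenspace A (ν : ℝ)).starProjection f) ⟨μ, hμ⟩ fun ν hν => by
        rw [h0 ν fun h => hν (Subtype.ext h), smul_zero]
    rw [h.unique h1]
    simp [Submodule.starProjection_eq_self_iff.2 hf]

/-- The square root of a compact positive operator squares to it. -/
theorem opPow_half_opPow_half {A : H →L[ℝ] H} (hc : IsCompactOperator A)
    (hA : (A : H →ₗ[ℝ] H).IsSymmetric) (hpos : ∀ f, 0 ≤ inner ℝ (A f) f) (f : H) :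
    opPow A (1 / 2) (opPow A (1 / 2) f) = A f := by
  set S := opPow A (1 / 2)
  -- The kernel of S² - A is closed and contains every eigenvector of A, and these span a dense
  -- subspace.
  have hle : (⨆ μ, Module.End.eigenspace (A : H →ₗ[ℝ] H) μ)
      ≤ ((S.comp S - A : H →L[ℝ] H)).ker := by
    refine iSup_le fun μ f hf => ?_
    rw [← eigenspace_eq_moduleEnd] at hf
    rw [LinearMap.mem_ker]
    change S (S f) - A f = 0
    by_cases hf0 : f = 0
    · simp [hf0]
    have hAf := mem_eigenspace.1 hf
    have hμ : 0 ≤ μ := by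
      have := hpos f
      rw [hAf, inner_smul_left, real_inner_self_eq_norm_sq] at this
      have h2 : 0 < ‖f‖ ^ 2 := by positivity
      exact nonneg_of_mul_nonneg_left this h2
    have hS : S f = μ ^ (1 / 2 : ℝ) • f :=
      opPow_apply_of_mem_eigenspace hc hA (by norm_num) hμ hf
    rw [hS, map_smul, hS, smul_smul, ← Real.rpow_add_of_nonneg hμ (by norm_num) (by norm_num), hAf]
    norm_num
  have hd := ContinuousLinearMap.orthogonalComplement_iSup_eigenspaces_eq_bot hc hA
  have hcl : IsClosed ((((S.comp S - A : H →L[ℝ] H)).ker : Submodule ℝ H) : Set H) :=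
    (S.comp S - A).isClosed_ker
  have htop : (⨆ μ, Module.End.eigenspace (A : H →ₗ[ℝ] H) μ).topologicalClosure = ⊤ :=
    Submodule.topologicalClosure_eq_top_iff.2 hd
  have hf : f ∈ ((S.comp S - A : H →L[ℝ] H)).ker :=
    Submodule.topologicalClosure_minimal _ hle hcl (htop ▸ Submodule.mem_top)
  exact sub_eq_zero.1 (LinearMap.mem_ker.1 hf)

/-- Both factors are compared with exponentials that cancel: (1 - z)^n ≤ e^{-nz}, while t ≤ e^t at t
= nz/r gives z^r ≤ (r/n)^r e^{nz}. -/
theorem rpow_mul_one_sub_pow_le {r z : ℝ} (hr : 0 < r) (hz : 0 < z) (hz1 : z ≤ 1) {n : ℕ}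
    (hn : 0 < n) : z ^ r * (1 - z) ^ n ≤ (r / n) ^ r := by
  have hn' : (0 : ℝ) < n := by exact_mod_cast hn
  have h1 : (1 - z) ^ n ≤ Real.exp (-(n * z)) := by
    calc (1 - z) ^ n ≤ (Real.exp (-z)) ^ n :=
          pow_le_pow_left₀ (by linarith) (by linarith [Real.add_one_le_exp (-z)]) n
      _ = Real.exp (-(n * z)) := by rw [← Real.exp_nat_mul]; ring_nf
  have h2 : z ≤ r / n * Real.exp (n * z / r) := by
    have h3 : n * z / r ≤ Real.exp (n * z / r) := by linarith [Real.add_one_le_exp (n * z / r)]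
    calc z = r / n * (n * z / r) := by field_simp
      _ ≤ _ := by gcongr
  have h4 : z ^ r ≤ (r / n) ^ r * Real.exp (n * z) := by
    calc z ^ r ≤ (r / n * Real.exp (n * z / r)) ^ r := Real.rpow_le_rpow hz.le h2 hr.le
      _ = (r / n) ^ r * Real.exp (n * z) := by
        rw [Real.mul_rpow (by positivity) (by positivity), ← Real.exp_mul]
        congr 2
        field_simp
  calc z ^ r * (1 - z) ^ n ≤ ((r / n) ^ r * Real.exp (n * z)) * Real.exp (-(n * z)) := by
        refine mul_le_mul h4 h1 (pow_nonneg (by linarith) n) (by positivity)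
    _ = (r / n) ^ r := by rw [mul_assoc, ← Real.exp_add]; simp

/-- The bias of `n` gradient steps of size `η` under a source condition of order `r`. -/
theorem norm_one_sub_pow_opPow_le {A : H →L[ℝ] H}
    (hA : (A : H →ₗ[ℝ] H).IsSymmetric)
    {η r : ℝ} (hr : 0 < r) (hη : 0 < η) (hηA : η * ‖A‖ ≤ 1) {n : ℕ} (hn : 0 < n) (f : H) :
    ‖((1 - η • A) ^ n) (opPow A r f)‖ ≤ (r / (η * n)) ^ r * ‖f‖ := by
  have hn' : (0 : ℝ) < n := by exact_mod_cast hn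
  -- A divergent series makes `opPow` zero by the default value of `tsum`, and the bound is then
  -- trivial; compactness of A is thus not required.
  by_cases hsum : Summable fun μ : {μ : ℝ // 0 < μ} =>
      (μ : ℝ) ^ r • (eigenspace A (μ : ℝ)).starProjection
  swap
  · rw [opPow, tsum_eq_zero_of_not_summable hsum]
    simp only [zero_apply, map_zero, norm_zero]
    positivity
  have h : HasSum _ (((1 - η • A) ^ n) (opPow A r f)) :=
    (hsum.hasSum.mapL (ContinuousLinearMap.apply ℝ H f)).mapL ((1 - η • A) ^ n)
  have heig : ∀ (μ : ℝ) (k : ℕ) (g : H), g ∈ eigenspace A μ →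
      ((1 - η • A) ^ k) g = (1 - η * μ) ^ k • g := by
    intro μ k g hg
    induction k with
    | zero => simp
    | succ k ih =>
      rw [pow_succ', mul_apply_eq_comp, ih, map_smul, sub_apply,
        one_apply_eq_self, smul_apply, mem_eigenspace.1 hg,
        pow_succ]
      module
  have hfun : (fun μ : {μ : ℝ // 0 < μ} => ((1 - η • A) ^ n)
      ((μ : ℝ) ^ r • (eigenspace A (μ : ℝ)).starProjection f)) = fun μ : {μ : ℝ // 0 < μ} =>
      ((μ : ℝ) ^ r * (1 - η * μ) ^ n) • (eigenspace A (μ : ℝ)).starProjection f := by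
    ext1 μ
    rw [map_smul, heig μ n _ (Submodule.starProjection_apply_mem _ f), smul_smul]
  replace h : HasSum _ (((1 - η • A) ^ n) (opPow A r f)) := hfun ▸ h
  refine le_of_tendsto (Filter.Tendsto.norm h) (Filter.Eventually.of_forall fun t => ?_)
  refine norm_sum_smul_starProjection_le _ (orthogonalFamily_pos_eigenspace hA)
    (fun μ : {μ : ℝ // 0 < μ} => (μ : ℝ) ^ r * (1 - η * μ) ^ n) (by positivity) t
    (fun μ _ hb => ?_) f
  obtain ⟨g, hg, hg0⟩ := (Submodule.ne_bot_iff _).1 hb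
  have hμA : (μ : ℝ) ≤ ‖A‖ := by
    have h1 := A.le_opNorm g
    rw [mem_eigenspace.1 hg, norm_smul, Real.norm_of_nonneg μ.2.le] at h1
    exact le_of_mul_le_mul_right h1 (norm_pos_iff.2 hg0)
  have hz1 : η * (μ : ℝ) ≤ 1 := (mul_le_mul_of_nonneg_left hμA hη.le).trans hηA
  have hz : 0 < η * (μ : ℝ) := mul_pos hη μ.2
  have hz2 : (0 : ℝ) ≤ 1 - η * μ := by linarith
  have hμ0 : (0 : ℝ) < μ := μ.2
  rw [abs_of_nonneg (by positivity)]
  have h3 := rpow_mul_one_sub_pow_le hr hz hz1 hn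
  rw [Real.mul_rpow hη.le hμ0.le] at h3
  have h4 : (r / (η * n)) ^ r = (r / n) ^ r / η ^ r := by
    rw [← Real.div_rpow (by positivity) hη.le]
    congr 1
    field_simp
  rw [h4, le_div_iff₀ (by positivity)]
  linarith

end Spectral

/-! ### Energy dissipation, the source of the variance bound. -/

/-- The energy `⟨p, K p⟩` decreases along `p ↦ p - η S S K p`, which bounds the total dissipation. -/
theorem sum_norm_sq_one_sub_pow_le {H : Type*} [NormedAddCommGroup H] [InnerProductSpace ℝ H]
    {S K : H →L[ℝ] H} (hS : (S : H →ₗ[ℝ] H).IsSymmetric) (hK : (K : H →ₗ[ℝ] H).IsSymmetric)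
    (hKpos : ∀ f, 0 ≤ inner ℝ (K f) f) {η : ℝ} (hη : 0 ≤ η)
    (hle : ∀ f, η * inner ℝ (S (K (S f))) f ≤ ‖f‖ ^ 2) (n : ℕ) (x : H) :
    η * ∑ k ∈ Finset.range n, ‖((1 - η • S.comp (K.comp S)) ^ k) (S (K x))‖ ^ 2
      ≤ inner ℝ (K x) x := by
  induction n generalizing x with
  | zero => simpa using hKpos x
  | succ n ih =>
    -- S K intertwines this step with 1 - η S K S, so the tail of the sum is the same sum started
    -- from p.
    set p := x - η • S (S (K x)) with hp
    have hSp : (1 - η • S.comp (K.comp S)) (S (K x)) = S (K p) := by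
      simp [hp]
    have hstep : inner ℝ (K p) p ≤ inner ℝ (K x) x - η * ‖S (K x)‖ ^ 2 := by
      have h1 : inner ℝ (K x) (S (S (K x))) = ‖S (K x)‖ ^ 2 := by
        rw [← real_inner_self_eq_norm_sq]
        exact (hS (K x) (S (K x))).symm
      have h2 : inner ℝ (K (S (S (K x)))) x = ‖S (K x)‖ ^ 2 := by
        rw [← h1, real_inner_comm]
        exact (hK x (S (S (K x)))).symm
      have h3 : inner ℝ (K (S (S (K x)))) (S (S (K x)))
          = inner ℝ (S (K (S (S (K x))))) (S (K x)) :=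
        (hS (K (S (S (K x)))) (S (K x))).symm
      -- The quadratic term of the energy expansion is at most η‖S K x‖², half of the first-order
      -- decrease 2η‖S K x‖².
      have h4 := hle (S (K x))
      have h5 : inner ℝ (K p) p = inner ℝ (K x) x - 2 * η * ‖S (K x)‖ ^ 2
          + η ^ 2 * inner ℝ (S (K (S (S (K x))))) (S (K x)) := by
        rw [hp, map_sub, map_smul, inner_sub_left, inner_sub_right, inner_sub_right,
          inner_smul_left, inner_smul_left, inner_smul_right, inner_smul_right, h1, h2, h3]
        simp
        ring
      rw [h5]
      nlinarith [mul_le_mul_of_nonneg_left h4 hη]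
    rw [Finset.sum_range_succ']
    have hpow : ∀ k : ℕ, ((1 - η • S.comp (K.comp S)) ^ (k + 1)) (S (K x))
        = ((1 - η • S.comp (K.comp S)) ^ k) (S (K p)) := fun k => by
      rw [pow_succ, mul_apply_eq_comp, hSp]
    simp only [hpow, pow_zero, one_apply_eq_self]
    have := ih p
    rw [mul_add]
    linarith

/-! ### Positivity and norm bounds for integral operators of reproducing kernels. -/

section Kernel

/-- Average the double sum over n + 1 independent points with law μ: the diagonal contributes J each
time and the other pairs I, so (n + 1)(nI + J) ≥ 0 for all n, which forces I ≥ 0. -/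
theorem integral_nonneg_of_sum_nonneg {E : Type*} [MeasurableSpace E] (μ : Measure E)
    [IsProbabilityMeasure μ] {F : E × E → ℝ} (hF : Integrable F (μ.prod μ))
    (hdiag : Integrable (fun u => F (u, u)) μ)
    (hpos : ∀ (n : ℕ) (u : Fin n → E), 0 ≤ ∑ i, ∑ j, F (u i, u j)) :
    0 ≤ ∫ z, F z ∂(μ.prod μ) := by
  set I := ∫ z, F z ∂(μ.prod μ)
  set J := ∫ u, F (u, u) ∂μ
  have hkey : ∀ n : ℕ, 0 ≤ (n : ℝ) * I + J := by
    intro n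
    let P : Measure (Fin (n + 1) → E) := Measure.pi fun _ => μ
    have heval : ∀ i, MeasurePreserving (fun u : Fin (n + 1) → E => u i) P μ :=
      fun i => measurePreserving_eval (fun _ => μ) i
    have hpair : ∀ i j, i ≠ j →
        MeasurePreserving (fun u : Fin (n + 1) → E => (u i, u j)) P (μ.prod μ) := by
      intro i j hij
      refine ⟨by fun_prop, ?_⟩
      have hind : iIndepFun (fun i (u : Fin (n + 1) → E) => u i) P :=
        iIndepFun_pi (X := fun _ => id) fun _ => aemeasurable_id
      have := (indepFun_iff_map_prod_eq_prod_map_map (heval i).measurable.aemeasurable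
        (heval j).measurable.aemeasurable).1 (hind.indepFun hij)
      rw [this, (heval i).map_eq, (heval j).map_eq]
    have hint : ∀ i j, Integrable (fun u : Fin (n + 1) → E => F (u i, u j)) P := by
      intro i j
      by_cases hij : i = j
      · subst hij
        exact (heval i).integrable_comp_of_integrable hdiag
      · exact (hpair i j hij).integrable_comp_of_integrable hF
    have hval : ∀ i j, ∫ u : Fin (n + 1) → E, F (u i, u j) ∂P = if i = j then J else I := by
      intro i j
      split_ifs with hij
      · subst hij
        have h := integral_map (φ := fun u : Fin (n + 1) → E => u i) (f := fun v => F (v, v))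
          (heval i).measurable.aemeasurable
          (by rw [(heval i).map_eq]; exact hdiag.aestronglyMeasurable)
        rw [(heval i).map_eq] at h
        simpa using h.symm
      · rw [← integral_map (φ := fun u : Fin (n + 1) → E => (u i, u j))
          (hpair i j hij).measurable.aemeasurable
          (by rw [(hpair i j hij).map_eq]; exact hF.aestronglyMeasurable), (hpair i j hij).map_eq]
    have h0 : 0 ≤ ∫ u : Fin (n + 1) → E, ∑ i, ∑ j, F (u i, u j) ∂P :=
      integral_nonneg fun u => hpos _ u
    rw [integral_finsetSum _ fun i _ => integrable_finsetSum _ fun j _ => hint i j] at h0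
    have h1 : ∀ i : Fin (n + 1), ∫ u : Fin (n + 1) → E, ∑ j, F (u i, u j) ∂P = n * I + J := by
      intro i
      rw [integral_finsetSum _ fun j _ => hint i j]
      simp only [hval]
      rw [← Finset.add_sum_erase _ _ (Finset.mem_univ i), if_pos rfl,
        Finset.sum_congr rfl fun j hj => if_neg (Finset.ne_of_mem_erase hj).symm]
      simp [add_comm]
    simp only [h1, Finset.sum_const, Finset.card_univ, Fintype.card_fin, nsmul_eq_mul] at h0
    exact nonneg_of_mul_nonneg_right h0 (by positivity)
  by_contra! hI
  obtain ⟨n, hn⟩ := exists_nat_gt (J / -I)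
  rw [div_lt_iff₀ (by linarith)] at hn
  linarith [hkey n]

variable {d : ℕ}

theorem integrable_coeFn (f : L2 d) : Integrable f volume :=
  (Lp.memLp f).integrable (by norm_num)

theorem integrable_kernel_mul (K : C(Cube d × Cube d, ℝ)) (f g : L2 d) :
    Integrable (fun z : Cube d × Cube d => K z * (g z.1 * f z.2)) (volume.prod volume) := by
  refine ((integrable_coeFn g).mul_prod (integrable_coeFn f)).bdd_mul (c := ‖K‖)
    K.continuous.aestronglyMeasurable ?_
  exact Filter.Eventually.of_forall fun z => K.norm_coe_le_norm z

theorem inner_integralOp (K : C(Cube d × Cube d, ℝ)) (f g : L2 d) :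
    inner ℝ (integralOp K f) g
      = ∫ z : Cube d × Cube d, K z * (g z.1 * f z.2) ∂(volume.prod volume) := by
  rw [integral_prod _ (integrable_kernel_mul K f g), L2.inner_def]
  refine integral_congr_ae ?_
  filter_upwards [integralOp_apply_ae K f] with u hu
  simp only [hu, RCLike.inner_apply, conj_trivial]
  rw [← integral_const_mul]
  congr 1
  ext v
  ring

theorem integralOp_isSymmetric {K : C(Cube d × Cube d, ℝ)} (hK : ∀ u v, K (u, v) = K (v, u)) :
    (integralOp K : L2 d →ₗ[ℝ] L2 d).IsSymmetric := by
  intro f g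
  simp only [ContinuousLinearMap.coe_coe]
  rw [real_inner_comm (integralOp K g) f, inner_integralOp, inner_integralOp, ← integral_prod_swap]
  congr 1
  ext ⟨u, v⟩
  simp only [Prod.swap_prod_mk]
  rw [hK]
  ring

namespace IsReproducingKernel

variable {K : C(Cube d × Cube d, ℝ)}

theorem sum_nonneg (hK : IsReproducingKernel K) (n : ℕ) (u : Fin n → Cube d) (c : Fin n → ℝ) :
    0 ≤ ∑ i, ∑ j, K (u i, u j) * (c i * c j) := by
  have h := (hK.posSemidef n u).dotProduct_mulVec_nonneg c
  simp only [dotProduct, Matrix.mulVec, star_trivial, Matrix.of_apply, Finset.mul_sum] at h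
  refine h.trans_eq (Finset.sum_congr rfl fun i _ => Finset.sum_congr rfl fun j _ => ?_)
  ring

theorem le_kappa_sq (K : C(Cube d × Cube d, ℝ)) (u : Cube d) : K (u, u) ≤ kappa K ^ 2 := by
  have hcont : Continuous fun u : Cube d => √(K (u, u)) := by fun_prop
  have hb : BddAbove (Set.range fun u : Cube d => √(K (u, u))) :=
    (isCompact_range hcont).bddAbove
  have h : √(K (u, u)) ≤ kappa K := le_ciSup hb u
  exact (Real.sqrt_le_left ((Real.sqrt_nonneg _).trans h)).1 h

/-- Testing the two-point Gram matrix on (1, 1) and (1, -1) bounds |K(u, v)| by the mean of K(u, u)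
and K(v, v). -/
theorem abs_le (hK : IsReproducingKernel K) (u v : Cube d) : |K (u, v)| ≤ kappa K ^ 2 := by
  have h1 := hK.sum_nonneg 2 ![u, v] ![1, 1]
  have h2 := hK.sum_nonneg 2 ![u, v] ![1, -1]
  simp [Fin.sum_univ_two, hK.symm v u] at h1 h2
  have := le_kappa_sq K u
  have := le_kappa_sq K v
  rw [_root_.abs_le]
  constructor <;> linarith

theorem norm_integralOp_apply_le (hK : IsReproducingKernel K) (f : L2 d) : ‖integralOp K f‖ ≤ kappa K ^ 2 * ‖f‖ := by
  -- The cube has total mass 1, so an almost everywhere bound is an L² bound. It serves twice: for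
  -- L_K f and for the section K(u, ·).
  have hb : ∀ (h : L2 d) (c : ℝ), 0 ≤ c → (∀ᵐ u, ‖h u‖ ≤ c) → ‖h‖ ≤ c := by
    intro h c hc hle
    simpa [measureUnivNNReal] using Lp.norm_le_of_ae_bound hc hle
  refine hb _ _ (by positivity) ?_
  filter_upwards [integralOp_apply_ae K f] with u hu
  rw [hu, integral_kernel_eq_inner]
  refine (norm_inner_le_norm _ _).trans ?_
  gcongr
  refine hb _ _ (by positivity) ?_
  filter_upwards [ContinuousMap.coeFn_toLp (p := 2) (𝕜 := ℝ) volume (K.curry u)] with v hv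
  rw [hv]
  exact hK.abs_le u v

theorem inner_integralOp_le (hK : IsReproducingKernel K) (f : L2 d) : inner ℝ (integralOp K f) f ≤ kappa K ^ 2 * ‖f‖ ^ 2 := by
  refine (real_inner_le_norm _ _).trans ?_
  nlinarith [hK.norm_integralOp_apply_le f, norm_nonneg f]

theorem inner_integralOp_nonneg (hK : IsReproducingKernel K) (f : L2 d) : 0 ≤ inner ℝ (integralOp K f) f := by
  rw [inner_integralOp]
  refine integral_nonneg_of_sum_nonneg volume (integrable_kernel_mul K f f) ?_
    fun n u => hK.sum_nonneg n u fun i => f (u i)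
  have hf : Integrable (fun u => f u * f u) volume := (Lp.memLp f).integrable_mul (Lp.memLp f)
  have hcont : Continuous fun u : Cube d => K (u, u) := by fun_prop
  refine hf.bdd_mul (c := ‖K‖) hcont.aestronglyMeasurable ?_
  exact Filter.Eventually.of_forall fun u => K.norm_coe_le_norm (u, u)

end IsReproducingKernel

end Kernel

/-! ### Countable orthonormal bases and measurability in L². -/

section HilbertBasis

variable {H : Type*} [NormedAddCommGroup H] [InnerProductSpace ℝ H]

/-- Orthonormal vectors are √2 apart, so balls of radius 1/2 around them are disjoint open sets. -/
theorem _root_.Orthonormal.countable_index {ι : Type*} {v : ι → H}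
    [SecondCountableTopology H] (hv : Orthonormal ℝ v) : Countable ι := by
  have hd : Pairwise fun i j => Disjoint (Metric.ball (v i) (1 / 2)) (Metric.ball (v j) (1 / 2)) := by
    intro i j hij
    refine Metric.ball_disjoint_ball ?_
    have h : ‖v i - v j‖ ^ 2 = 2 := by
      rw [norm_sub_sq_real, hv.2 hij, hv.1 i, hv.1 j]
      norm_num
    rw [dist_eq_norm]
    nlinarith [norm_nonneg (v i - v j)]
  exact Pairwise.countable_of_isOpen_disjoint hd (fun _ => Metric.isOpen_ball)
    fun i => ⟨v i, Metric.mem_ball_self (by norm_num)⟩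

theorem isCompactOperator_rankOne (x y : H) :
    IsCompactOperator (InnerProductSpace.rankOne ℝ x y) := by
  rw [InnerProductSpace.rankOne_def']
  exact (isCompactOperator_of_locallyCompactSpace_rng
    (ContinuousLinearMap.toSpanSingleton ℝ x)).comp_clm _

variable [CompleteSpace H]

variable (H) in
theorem exists_countable_hilbertBasis [SecondCountableTopology H] :
    ∃ (w : Set H) (_ : HilbertBasis w ℝ H), Countable w := by
  obtain ⟨w, b, -⟩ := exists_hilbertBasis ℝ H
  exact ⟨w, b, b.orthonormal.countable_index⟩

/-- A weakly measurable map into a separable Hilbert space is measurable. -/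
theorem measurable_of_forall_inner [SecondCountableTopology H] [MeasurableSpace H] [BorelSpace H]
    {Ω : Type*} [MeasurableSpace Ω] {F : Ω → H} (hF : ∀ g, Measurable fun ω => inner ℝ g (F ω)) :
    Measurable F := by
  obtain ⟨w, b, hw⟩ := exists_countable_hilbertBasis H
  refine measurable_of_tendsto_metrizable' Filter.atTop
    (f := fun (s : Finset w) ω => ∑ i ∈ s, inner ℝ (b i) (F ω) • b i) (fun s => ?_) ?_
  · exact Finset.measurable_sum _ fun i _ => (hF (b i)).smul_const (b i)
  · rw [tendsto_pi_nhds]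
    intro ω
    have h := b.hasSum_repr (F ω)
    simp only [b.repr_apply_apply] at h
    exact h

end HilbertBasis

instance instSecondCountableTopologyL2 (d : ℕ) : SecondCountableTopology (L2 d) :=
  have : Fact ((2 : ℝ≥0∞) ≠ ∞) := ⟨ENNReal.ofNat_ne_top⟩
  have : IsSeparable (volume : Measure (Cube d)) :=
    instIsSeparableOfCountablyGeneratedOfSFinite _
  Lp.SecondCountableTopology

theorem toL2_of_memLp {d : ℕ} {f : Cube d → ℝ} (hf : MemLp f 2 volume) : toL2 f = hf.toLp f := by
  rw [toL2, dif_pos hf]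

/-- Weak measurability suffices. Each pairing is a parameter integral on the set of square
integrable paths and 0 elsewhere; that set is measurable by Tonelli. -/
theorem measurable_toL2 {d : ℕ} {Ω : Type*} [MeasurableSpace Ω] {X : Ω → Cube d → ℝ}
    (hX : Measurable (Function.uncurry X)) : Measurable fun ω => toL2 (X ω) := by
  have hsec : ∀ ω, AEStronglyMeasurable (X ω) volume := fun ω =>
    (hX.comp measurable_prodMk_left).aestronglyMeasurable
  have hs : MeasurableSet {ω | MemLp (X ω) 2 volume} := by
    have heq : {ω | MemLp (X ω) 2 volume} = {ω | ∫⁻ u, ‖X ω u‖ₑ ^ (2 : ℝ) < ∞} := by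
      ext ω
      simp only [Set.mem_ofPred_eq]
      rw [MemLp, and_iff_right (hsec ω), eLpNorm_lt_top_iff_lintegral_rpow_enorm_lt_top
        two_ne_zero ENNReal.ofNat_ne_top]
      simp
    rw [heq]
    refine measurableSet_lt ?_ measurable_const
    exact Measurable.lintegral_prod_right' (f := fun z : Ω × Cube d => ‖X z.1 z.2‖ₑ ^ (2 : ℝ))
      (hX.enorm.pow_const _)
  refine measurable_of_forall_inner fun g => ?_
  have hint : Measurable fun ω => ∫ u, X ω u * g u :=
    (StronglyMeasurable.integral_prod_right' (f := fun z : Ω × Cube d => X z.1 z.2 * g z.2)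
      (hX.stronglyMeasurable.mul
        ((Lp.stronglyMeasurable g).comp_measurable measurable_snd))).measurable
  classical
  have hpw : (fun ω => inner ℝ g (toL2 (X ω)))
      = fun ω => if MemLp (X ω) 2 volume then ∫ u, X ω u * g u else 0 := by
    ext ω
    split_ifs with h
    · rw [toL2_of_memLp h, L2.inner_def]
      refine integral_congr_ae ?_
      filter_upwards [h.coeFn_toLp] with u hu
      simp [hu]
    · rw [toL2, dif_neg h, inner_zero_right]
  rw [hpw]
  exact Measurable.ite hs hint measurable_const

/-! ### The random function, its noise and its covariance operator. -/

namespace FLModel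

variable {d : ℕ} {Ω : Type*} [MeasurableSpace Ω] {P : Measure Ω} (M : FLModel d P)

theorem measurable_XL : Measurable M.XL := measurable_toL2 M.measurable_X

theorem norm_XL : ∀ᵐ ω ∂P, ‖M.XL ω‖ = 1 := M.norm_X

theorem memLp_section : ∀ᵐ ω ∂P, MemLp (M.X ω) 2 volume := by
  filter_upwards [M.norm_X] with ω hω
  by_contra h
  rw [toL2, dif_neg h] at hω
  simp at hω

theorem inner_XL : ∀ᵐ ω ∂P, ∀ f : L2 d, inner ℝ (M.XL ω) f = ∫ u, M.X ω u * f u := by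
  filter_upwards [M.memLp_section] with ω hω f
  rw [XL, toL2_of_memLp hω, L2.inner_def]
  refine integral_congr_ae ?_
  filter_upwards [hω.coeFn_toLp] with u hu
  simp [hu, mul_comm]

theorem C_symm (u v : Cube d) : M.C (u, v) = M.C (v, u) := by
  rw [M.cov_X, M.cov_X]
  simp only [mul_comm]

theorem abs_inner_XL_le (f : L2 d) : ∀ᵐ ω ∂P, |inner ℝ (M.XL ω) f| ≤ ‖f‖ := by
  filter_upwards [M.norm_XL] with ω hω
  simpa [hω] using abs_real_inner_le_norm (M.XL ω) f

/-- A bound on the unit sphere is enough because ‖X‖ = 1 almost surely; thus polynomials in X are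
allowed weights here and below. -/
theorem integrable_noise_sq_mul {h : L2 d → ℝ} (hh : Measurable h) {c : ℝ}
    (hb : ∀ x, ‖x‖ = 1 → |h x| ≤ c) : Integrable (fun ω => h (M.XL ω) * M.noise ω ^ 2) P := by
  refine M.memLp_noise.integrable_sq.bdd_mul (c := c)
    (hh.comp M.measurable_XL).aestronglyMeasurable ?_
  filter_upwards [M.norm_XL] with ω hω
  exact hb _ hω

theorem integral_abs_mul_le (u v : Cube d) :
    ∫ ω, |M.X ω u * M.X ω v| ∂P ≤ ‖M.C‖ := by
  have hu := M.memLp_X u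
  have hv := M.memLp_X v
  have h1 : ∀ u, M.C (u, u) ≤ ‖M.C‖ := fun u => (le_abs_self _).trans (M.C.norm_coe_le_norm _)
  have h2 : ∫ ω, |M.X ω u * M.X ω v| ∂P ≤ ∫ ω, (M.X ω u ^ 2 + M.X ω v ^ 2) / 2 ∂P := by
    refine integral_mono (hu.integrable_mul hv).abs
      ((hu.integrable_sq.add hv.integrable_sq).div_const 2) fun ω => ?_
    simp only [abs_mul]
    have := sq_nonneg (|M.X ω u| - |M.X ω v|)
    rw [← sq_abs (M.X ω u), ← sq_abs (M.X ω v)]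
    linarith
  have h3 : ∀ u, ∫ ω, M.X ω u ^ 2 ∂P = M.C (u, u) := fun u => by simp only [M.cov_X, sq]
  rw [integral_div, integral_add hu.integrable_sq hv.integrable_sq, h3, h3] at h2
  linarith [h1 u, h1 v]

variable [IsProbabilityMeasure P]

/-- A bounded measurable function of `X` is integrable. -/
theorem integrable_comp_XL {h : L2 d → ℝ} (hh : Measurable h) {c : ℝ}
    (hb : ∀ x, ‖x‖ = 1 → |h x| ≤ c) : Integrable (fun ω => h (M.XL ω)) P := by
  refine Integrable.of_bound (hh.comp M.measurable_XL).aestronglyMeasurable c ?_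
  filter_upwards [M.norm_XL] with ω hω
  exact hb _ hω

theorem integrable_noise : Integrable M.noise P := M.memLp_noise.integrable one_le_two

theorem integrable_noise_mul {h : L2 d → ℝ} (hh : Measurable h) {c : ℝ}
    (hb : ∀ x, ‖x‖ = 1 → |h x| ≤ c) : Integrable (fun ω => h (M.XL ω) * M.noise ω) P := by
  refine M.integrable_noise.bdd_mul (c := c) (hh.comp M.measurable_XL).aestronglyMeasurable ?_
  filter_upwards [M.norm_XL] with ω hω
  exact hb _ hω

theorem integral_noise_mul {h : L2 d → ℝ} (hh : Measurable h) {c : ℝ}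
    (hb : ∀ x, ‖x‖ = 1 → |h x| ≤ c) : ∫ ω, h (M.XL ω) * M.noise ω ∂P = 0 := by
  have hm := M.measurable_XL.comap_le
  have hsm : StronglyMeasurable[MeasurableSpace.comap M.XL inferInstance]
      (fun ω => h (M.XL ω)) := (hh.comp (comap_measurable M.XL)).stronglyMeasurable
  have h1 := condExp_mul_of_stronglyMeasurable_left hsm (M.integrable_noise_mul hh hb)
    M.integrable_noise
  have h2 := integral_condExp hm (μ := P) (f := (fun ω => h (M.XL ω)) * M.noise)
  change ∫ ω, ((fun ω => h (M.XL ω)) * M.noise) ω ∂P = 0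
  rw [← h2, integral_congr_ae h1]
  refine integral_eq_zero_of_ae ?_
  filter_upwards [M.noise_mean] with ω hω
  simp only [Pi.mul_apply, Pi.zero_apply]
  exact mul_eq_zero_of_right _ hω

theorem integral_noise_sq_mul {h : L2 d → ℝ} (hh : Measurable h) {c : ℝ}
    (hb : ∀ x, ‖x‖ = 1 → |h x| ≤ c) :
    ∫ ω, h (M.XL ω) * M.noise ω ^ 2 ∂P = (∫ ω, h (M.XL ω) ∂P) * Var[M.noise; P] := by
  have hm := M.measurable_XL.comap_le
  have hsm : StronglyMeasurable[MeasurableSpace.comap M.XL inferInstance]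
      (fun ω => h (M.XL ω)) := (hh.comp (comap_measurable M.XL)).stronglyMeasurable
  have h1 := condExp_mul_of_stronglyMeasurable_left hsm (M.integrable_noise_sq_mul hh hb)
    M.memLp_noise.integrable_sq
  have h2 := integral_condExp hm (μ := P)
    (f := (fun ω => h (M.XL ω)) * fun ω => M.noise ω ^ 2)
  change ∫ ω, ((fun ω => h (M.XL ω)) * fun ω => M.noise ω ^ 2) ω ∂P = _
  rw [← h2, integral_congr_ae h1, ← integral_mul_const]
  refine integral_congr_ae ?_
  filter_upwards [M.noise_var] with ω hω
  simp only [Pi.mul_apply]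
  exact congrArg _ hω

/-- This licenses the Fubini exchange that identifies the covariance operator: E|X(u) X(v)| ≤ ‖C‖
leaves the integrable majorant ‖C‖ |g(u) f(v)|. -/
theorem integrable_X_mul_X (f g : L2 d) :
    Integrable (fun z : Ω × (Cube d × Cube d) =>
      (M.X z.1 z.2.1 * g z.2.1) * (M.X z.1 z.2.2 * f z.2.2)) (P.prod (volume.prod volume)) := by
  have hX1 : Measurable fun z : Ω × (Cube d × Cube d) => M.X z.1 z.2.1 :=
    M.measurable_X.comp (measurable_fst.prodMk (measurable_fst.comp measurable_snd))
  have hX2 : Measurable fun z : Ω × (Cube d × Cube d) => M.X z.1 z.2.2 :=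
    M.measurable_X.comp (measurable_fst.prodMk (measurable_snd.comp measurable_snd))
  have hg : Measurable fun z : Ω × (Cube d × Cube d) => g z.2.1 :=
    (Lp.stronglyMeasurable g).measurable.comp (measurable_fst.comp measurable_snd)
  have hf : Measurable fun z : Ω × (Cube d × Cube d) => f z.2.2 :=
    (Lp.stronglyMeasurable f).measurable.comp (measurable_snd.comp measurable_snd)
  have hmeas := ((hX1.mul hg).mul (hX2.mul hf)).aestronglyMeasurable
    (μ := P.prod (volume.prod volume))
  refine (integrable_prod_iff' hmeas).2 ⟨Filter.Eventually.of_forall fun z => ?_, ?_⟩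
  · have h := ((M.memLp_X z.1).integrable_mul (M.memLp_X z.2)).mul_const (g z.1 * f z.2)
    convert! h using 2 with ω
    simp only [Pi.mul_apply]
    ring
  · refine Integrable.mono' (g := fun z : Cube d × Cube d => ‖M.C‖ * |g z.1 * f z.2|)
      (((integrable_coeFn g).mul_prod (integrable_coeFn f)).abs.const_mul _)
      hmeas.norm.prod_swap.integral_prod_right' ?_
    refine Filter.Eventually.of_forall fun z => ?_
    have h : ∀ ω, ‖(M.X ω z.1 * g z.1) * (M.X ω z.2 * f z.2)‖
        = |M.X ω z.1 * M.X ω z.2| * |g z.1 * f z.2| := fun ω => by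
      rw [Real.norm_eq_abs, ← abs_mul]
      ring_nf
    change ‖∫ ω, ‖(M.X ω z.1 * g z.1) * (M.X ω z.2 * f z.2)‖ ∂P‖ ≤ _
    simp only [h]
    rw [integral_mul_const, norm_mul, Real.norm_of_nonneg (integral_nonneg fun ω => abs_nonneg _),
      Real.norm_of_nonneg (abs_nonneg _)]
    exact mul_le_mul_of_nonneg_right (M.integral_abs_mul_le _ _) (abs_nonneg _)

/-- The covariance operator is `E[X ⊗ X]`. -/
theorem inner_integralOp_C (f g : L2 d) :
    inner ℝ (integralOp M.C f) g = ∫ ω, inner ℝ (M.XL ω) f * inner ℝ (M.XL ω) g ∂P := by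
  have h1 : ∫ ω, inner ℝ (M.XL ω) f * inner ℝ (M.XL ω) g ∂P
      = ∫ ω, ∫ z : Cube d × Cube d, (M.X ω z.1 * g z.1) * (M.X ω z.2 * f z.2)
        ∂(volume.prod volume) ∂P := by
    refine integral_congr_ae ?_
    filter_upwards [M.inner_XL] with ω hω
    rw [hω, hω, mul_comm, integral_prod_mul (fun u => M.X ω u * g u) fun v => M.X ω v * f v]
  rw [h1, inner_integralOp, integral_integral_swap (M.integrable_X_mul_X f g)]
  congr 1
  ext z
  rw [← Prod.mk.eta (p := z), M.cov_X, ← integral_mul_const]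
  congr 1
  ext ω
  ring

theorem inner_integralOp_C_nonneg (f : L2 d) : 0 ≤ inner ℝ (integralOp M.C f) f := by
  rw [M.inner_integralOp_C]
  exact integral_nonneg fun ω => mul_self_nonneg _

theorem inner_integralOp_C_le (f : L2 d) : inner ℝ (integralOp M.C f) f ≤ ‖f‖ ^ 2 := by
  rw [M.inner_integralOp_C]
  have h : ∀ᵐ ω ∂P, inner ℝ (M.XL ω) f * inner ℝ (M.XL ω) f ≤ ‖f‖ ^ 2 := by
    filter_upwards [M.abs_inner_XL_le f] with ω hω
    rw [← sq, ← sq_abs]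
    exact pow_le_pow_left₀ (abs_nonneg _) hω 2
  have := integral_mono_of_nonneg (Filter.Eventually.of_forall fun ω => mul_self_nonneg _)
    (integrable_const (‖f‖ ^ 2)) h
  simpa using this

/-- The operator is the Bochner integral of the rank-one operators X ⊗ X, and the compact operators
form a closed convex set. -/
theorem isCompactOperator_integralOp_C : IsCompactOperator (integralOp M.C) := by
  let R : Ω → L2 d →L[ℝ] L2 d := fun ω => InnerProductSpace.rankOne ℝ (M.XL ω) (M.XL ω)
  have hcont : Continuous fun x : L2 d => InnerProductSpace.rankOne ℝ x x :=
    (InnerProductSpace.rankOne ℝ).continuous.clm_apply continuous_id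
  have hR : Integrable R P := by
    refine Integrable.of_bound (hcont.comp_aestronglyMeasurable
      M.measurable_XL.aestronglyMeasurable) 1 ?_
    filter_upwards [M.norm_XL] with ω hω
    simp [R, hω]
  have hA : integralOp M.C = ∫ ω, R ω ∂P := by
    ext1 f
    refine ext_inner_right ℝ fun g => ?_
    rw [M.inner_integralOp_C, ContinuousLinearMap.integral_apply hR, real_inner_comm,
      ← integral_inner (hR.apply_continuousLinearMap f)]
    congr 1
    ext ω
    simp [R, inner_smul_right, real_inner_comm]
  rw [hA]
  refine Convex.integral_mem (s := {T : L2 d →L[ℝ] L2 d | IsCompactOperator T}) ?_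
    isClosed_setOfPred_isCompactOperator (Filter.Eventually.of_forall fun ω => ?_) hR
  · exact (compactOperator (RingHom.id ℝ) (L2 d) (L2 d)).convex
  · exact isCompactOperator_rankOne _ _

end FLModel

/-- A gradient step with a small step size is a contraction. -/
theorem norm_one_sub_smul_apply_le {H : Type*} [NormedAddCommGroup H] [InnerProductSpace ℝ H]
    {A : H →L[ℝ] H} (hA : (A : H →ₗ[ℝ] H).IsSymmetric) (hpos : ∀ f, 0 ≤ inner ℝ (A f) f)
    {η : ℝ} (hη : 0 ≤ η) (hle : ∀ f, η * inner ℝ (A f) f ≤ ‖f‖ ^ 2) (f : H) :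
    ‖(1 - η • A) f‖ ≤ ‖f‖ := by
  have h1 : inner ℝ (A (A f)) f = ‖A f‖ ^ 2 := by
    rw [← real_inner_self_eq_norm_sq]
    exact hA (A f) f
  -- Together with `hle` at A f this yields η‖A f‖² ≤ ⟨A f, f⟩, with no square root of A.
  have h2 := hpos (f - η • A f)
  rw [map_sub, map_smul, inner_sub_left, inner_sub_right, inner_sub_right, inner_smul_left,
    inner_smul_left, inner_smul_right, inner_smul_right, h1, real_inner_self_eq_norm_sq] at h2
  simp only [conj_trivial] at h2
  have h3 := mul_le_mul_of_nonneg_left (hle (A f)) hη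
  have h4 : ‖(1 - η • A) f‖ ^ 2 = ‖f‖ ^ 2 - 2 * (η * inner ℝ (A f) f) + η ^ 2 * ‖A f‖ ^ 2 := by
    rw [sub_apply, one_apply_eq_self, smul_apply, norm_sub_sq_real, inner_smul_right, norm_smul,
      mul_pow, Real.norm_eq_abs, sq_abs, real_inner_comm]
  have h5 : 0 ≤ η * (inner ℝ (A f) f - η * ‖A f‖ ^ 2) := mul_nonneg hη (by nlinarith)
  have h6 := mul_nonneg hη (hpos f)
  exact (sq_le_sq₀ (norm_nonneg _) (norm_nonneg _)).1 (by rw [h4]; nlinarith)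

/-! ### The operator 𝓛_K, moment inequalities and one stochastic gradient step. -/

namespace FLModel

variable {d : ℕ} {Ω : Type*} [MeasurableSpace Ω] {P : Measure Ω} (M : FLModel d P)

/-- The square root `L_C^{1/2}` of the covariance operator. -/
noncomputable def sqrtCov : L2 d →L[ℝ] L2 d := opPow (integralOp M.C) (1 / 2)

variable [IsProbabilityMeasure P]

theorem sqrtCov_isSymmetric : (M.sqrtCov : L2 d →ₗ[ℝ] L2 d).IsSymmetric :=
  opPow_isSymmetric M.isCompactOperator_integralOp_C (integralOp_isSymmetric M.C_symm)
    (by norm_num)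

theorem sqrtCov_sqrtCov (f : L2 d) : M.sqrtCov (M.sqrtCov f) = integralOp M.C f :=
  opPow_half_opPow_half M.isCompactOperator_integralOp_C (integralOp_isSymmetric M.C_symm)
    M.inner_integralOp_C_nonneg f

theorem inner_sqrtCov (f g : L2 d) :
    inner ℝ (M.sqrtCov f) (M.sqrtCov g) = inner ℝ (integralOp M.C f) g := by
  rw [← M.sqrtCov_sqrtCov]
  exact (M.sqrtCov_isSymmetric (M.sqrtCov f) g).symm

theorem norm_sqrtCov_sq (f : L2 d) : ‖M.sqrtCov f‖ ^ 2 = ∫ ω, inner ℝ (M.XL ω) f ^ 2 ∂P := by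
  rw [← real_inner_self_eq_norm_sq, M.inner_sqrtCov, M.inner_integralOp_C]
  simp only [sq]

theorem norm_sqrtCov_le (f : L2 d) : ‖M.sqrtCov f‖ ≤ ‖f‖ := by
  refine (sq_le_sq₀ (norm_nonneg _) (norm_nonneg _)).1 ?_
  rw [← real_inner_self_eq_norm_sq, M.inner_sqrtCov]
  exact M.inner_integralOp_C_le f

theorem scrL_isSymmetric {K : C(Cube d × Cube d, ℝ)} (hK : IsReproducingKernel K) :
    (scrL M.C K : L2 d →ₗ[ℝ] L2 d).IsSymmetric := by
  intro f g
  change inner ℝ (M.sqrtCov (integralOp K (M.sqrtCov f))) g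
    = inner ℝ f (M.sqrtCov (integralOp K (M.sqrtCov g)))
  have h1 := M.sqrtCov_isSymmetric (integralOp K (M.sqrtCov f)) g
  have h2 := integralOp_isSymmetric hK.symm (M.sqrtCov f) (M.sqrtCov g)
  have h3 := M.sqrtCov_isSymmetric f (integralOp K (M.sqrtCov g))
  exact h1.trans (h2.trans h3)

theorem inner_scrL_nonneg {K : C(Cube d × Cube d, ℝ)} (hK : IsReproducingKernel K) (f : L2 d) :
    0 ≤ inner ℝ (scrL M.C K f) f :=
  (hK.inner_integralOp_nonneg (M.sqrtCov f)).trans_eq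
    (M.sqrtCov_isSymmetric (integralOp K (M.sqrtCov f)) f).symm

theorem norm_scrL_le {K : C(Cube d × Cube d, ℝ)} (hK : IsReproducingKernel K) :
    ‖scrL M.C K‖ ≤ kappa K ^ 2 := by
  refine ContinuousLinearMap.opNorm_le_bound _ (sq_nonneg _) fun f => ?_
  refine (M.norm_sqrtCov_le (integralOp K (M.sqrtCov f))).trans ?_
  refine (hK.norm_integralOp_apply_le _).trans ?_
  exact mul_le_mul_of_nonneg_left (M.norm_sqrtCov_le f) (sq_nonneg _)

theorem mul_inner_scrL_le {K : C(Cube d × Cube d, ℝ)} (hK : IsReproducingKernel K) {η : ℝ}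
    (hη : 0 ≤ η) (hη1 : η * kappa K ^ 2 ≤ 1) (f : L2 d) :
    η * inner ℝ (scrL M.C K f) f ≤ ‖f‖ ^ 2 := by
  have h1 : inner ℝ (scrL M.C K f) f ≤ kappa K ^ 2 * ‖f‖ ^ 2 := by
    refine (real_inner_le_norm _ _).trans ?_
    have := (scrL M.C K).le_of_opNorm_le (M.norm_scrL_le hK) f
    nlinarith [norm_nonneg f]
  calc η * inner ℝ (scrL M.C K f) f ≤ η * (kappa K ^ 2 * ‖f‖ ^ 2) := by gcongr
    _ = (η * kappa K ^ 2) * ‖f‖ ^ 2 := by ring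
    _ ≤ ‖f‖ ^ 2 := mul_le_of_le_one_left (sq_nonneg _) hη1

theorem measurable_inner_right (f : L2 d) : Measurable fun x : L2 d => (inner ℝ x f : ℝ) :=
  (continuous_id.inner continuous_const).measurable

theorem abs_inner_le_of_norm_eq_one (f : L2 d) {x : L2 d} (hx : ‖x‖ = 1) :
    |(inner ℝ x f : ℝ)| ≤ ‖f‖ := by
  simpa [hx] using abs_real_inner_le_norm x f

theorem integrable_inner_pow_mul_inner_pow (e h : L2 d) (m n : ℕ) :
    Integrable (fun ω => (inner ℝ (M.XL ω) e : ℝ) ^ m * inner ℝ (M.XL ω) h ^ n) P := by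
  refine M.integrable_comp_XL (h := fun x => (inner ℝ x e : ℝ) ^ m * inner ℝ x h ^ n)
    (((measurable_inner_right e).pow_const m).mul ((measurable_inner_right h).pow_const n))
    (c := ‖e‖ ^ m * ‖h‖ ^ n) fun x hx => ?_
  rw [abs_mul, abs_pow, abs_pow]
  gcongr
  · exact abs_inner_le_of_norm_eq_one e hx
  · exact abs_inner_le_of_norm_eq_one h hx

theorem integrable_inner_pow (e : L2 d) (m : ℕ) :
    Integrable (fun ω => (inner ℝ (M.XL ω) e : ℝ) ^ m) P := by
  simpa using M.integrable_inner_pow_mul_inner_pow e e m 0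

theorem integrable_norm_sq (T : L2 d →L[ℝ] L2 d) : Integrable (fun ω => ‖T (M.XL ω)‖ ^ 2) P := by
  refine M.integrable_comp_XL (h := fun x => ‖T x‖ ^ 2) (by fun_prop) (c := ‖T‖ ^ 2) fun x hx => ?_
  rw [abs_of_nonneg (sq_nonneg _)]
  gcongr
  simpa [hx] using T.le_opNorm x

variable {M} {cM : ℝ}

/-- Cauchy–Schwarz, read off the discriminant of t ↦ E(t⟨X, e⟩² - ⟨X, h⟩²)², reduces the mixed
moment to two fourth moments. -/
theorem integral_inner_sq_mul_inner_sq_le (hcM : 0 ≤ cM)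
    (hmom : ∀ f : L2 d, ∫ ω, (inner ℝ (M.XL ω) f) ^ 4 ∂P
      ≤ cM * (∫ ω, (inner ℝ (M.XL ω) f) ^ 2 ∂P) ^ 2) (e h : L2 d) :
    ∫ ω, (inner ℝ (M.XL ω) e : ℝ) ^ 2 * inner ℝ (M.XL ω) h ^ 2 ∂P
      ≤ cM * ‖M.sqrtCov e‖ ^ 2 * ‖M.sqrtCov h‖ ^ 2 := by
  set a := ∫ ω, (inner ℝ (M.XL ω) e : ℝ) ^ 4 ∂P
  set b := ∫ ω, (inner ℝ (M.XL ω) h : ℝ) ^ 4 ∂P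
  set c := ∫ ω, (inner ℝ (M.XL ω) e : ℝ) ^ 2 * inner ℝ (M.XL ω) h ^ 2 ∂P
  have hab : ∀ t : ℝ, 0 ≤ a * (t * t) + (-2 * c) * t + b := by
    intro t
    have h1 : ∫ ω, (t * (inner ℝ (M.XL ω) e : ℝ) ^ 2 - inner ℝ (M.XL ω) h ^ 2) ^ 2 ∂P
        = t * t * a - 2 * t * c + b := by
      rw [← integral_const_mul, ← integral_const_mul, ← integral_sub, ← integral_add]
      · congr 1
        ext ω
        ring
      · exact ((M.integrable_inner_pow e 4).const_mul _).sub
          ((M.integrable_inner_pow_mul_inner_pow e h 2 2).const_mul _)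
      · exact M.integrable_inner_pow h 4
      · exact (M.integrable_inner_pow e 4).const_mul _
      · exact (M.integrable_inner_pow_mul_inner_pow e h 2 2).const_mul _
    have h2 : 0 ≤ ∫ ω, (t * (inner ℝ (M.XL ω) e : ℝ) ^ 2 - inner ℝ (M.XL ω) h ^ 2) ^ 2 ∂P :=
      integral_nonneg fun ω => sq_nonneg _
    linarith
  have hd := discrim_le_zero hab
  rw [discrim] at hd
  have he := hmom e
  have hh := hmom h
  rw [← M.norm_sqrtCov_sq] at he hh
  have hb0 : 0 ≤ b := integral_nonneg fun ω => by positivity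
  refine abs_le_of_sq_le_sq' ?_ (by positivity) |>.2
  have h3 : c ^ 2 ≤ a * b := by linarith
  calc c ^ 2 ≤ a * b := h3
    _ ≤ (cM * (‖M.sqrtCov e‖ ^ 2) ^ 2) * (cM * (‖M.sqrtCov h‖ ^ 2) ^ 2) :=
        mul_le_mul he hh hb0 (by positivity)
    _ = _ := by ring

/-- By Parseval ‖T X‖² is the sum of ⟨X, T* b_i⟩² over an orthonormal basis, so the scalar
inequality is summed over i. Countability of the basis allows exchanging sum and expectation. -/
theorem integral_inner_sq_mul_norm_sq_le (hcM : 0 ≤ cM)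
    (hmom : ∀ f : L2 d, ∫ ω, (inner ℝ (M.XL ω) f) ^ 4 ∂P
      ≤ cM * (∫ ω, (inner ℝ (M.XL ω) f) ^ 2 ∂P) ^ 2) (e : L2 d) (T : L2 d →L[ℝ] L2 d) :
    ∫ ω, (inner ℝ (M.XL ω) e : ℝ) ^ 2 * ‖T (M.XL ω)‖ ^ 2 ∂P
      ≤ cM * ‖M.sqrtCov e‖ ^ 2 * ∫ ω, ‖T (M.XL ω)‖ ^ 2 ∂P := by
  obtain ⟨w, b, hw⟩ := exists_countable_hilbertBasis (L2 d)
  let g : w → L2 d := fun i => T.adjoint (b i)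
  have hparseval : ∀ x, HasSum (fun i => (inner ℝ x (g i) : ℝ) ^ 2) (‖T x‖ ^ 2) := by
    intro x
    have h := b.hasSum_inner_mul_inner (T x) (T x)
    rw [real_inner_self_eq_norm_sq] at h
    convert! h using 2 with i
    rw [ContinuousLinearMap.adjoint_inner_right, sq, real_inner_comm (T x)]
  have hF : ∀ i, Integrable (fun ω => (inner ℝ (M.XL ω) (g i) : ℝ) ^ 2) P :=
    fun i => M.integrable_inner_pow _ 2
  have hsumF : Summable fun i => ∫ ω, (inner ℝ (M.XL ω) (g i) : ℝ) ^ 2 ∂P := by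
    refine summable_of_sum_le (c := ∫ ω, ‖T (M.XL ω)‖ ^ 2 ∂P)
      (fun i => integral_nonneg fun ω => sq_nonneg _) fun s => ?_
    rw [← integral_finsetSum _ fun i _ => hF i]
    exact integral_mono (integrable_finsetSum _ fun i _ => hF i) (M.integrable_norm_sq T)
      fun ω => sum_le_hasSum s (fun i _ => sq_nonneg _) (hparseval (M.XL ω))
  have h1 := hasSum_integral_of_summable_integral_norm hF (by simpa using hsumF)
  simp only [(hparseval _).tsum_eq] at h1
  have hG : ∀ i, Integrable (fun ω => (inner ℝ (M.XL ω) e : ℝ) ^ 2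
      * inner ℝ (M.XL ω) (g i) ^ 2) P := fun i => M.integrable_inner_pow_mul_inner_pow e _ 2 2
  have hle : ∀ i, ∫ ω, (inner ℝ (M.XL ω) e : ℝ) ^ 2 * inner ℝ (M.XL ω) (g i) ^ 2 ∂P
      ≤ cM * ‖M.sqrtCov e‖ ^ 2 * ∫ ω, (inner ℝ (M.XL ω) (g i) : ℝ) ^ 2 ∂P := fun i => by
    rw [← M.norm_sqrtCov_sq (g i)]
    exact integral_inner_sq_mul_inner_sq_le hcM hmom e (g i)
  have hsumG : Summable fun i => ∫ ω, (inner ℝ (M.XL ω) e : ℝ) ^ 2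
      * inner ℝ (M.XL ω) (g i) ^ 2 ∂P :=
    Summable.of_nonneg_of_le (fun i => integral_nonneg fun ω => by positivity) hle
      (hsumF.mul_left _)
  have h2 := hasSum_integral_of_summable_integral_norm hG (by simpa using hsumG)
  simp only [tsum_mul_left, (hparseval _).tsum_eq] at h2
  exact hasSum_le hle h2 (h1.mul_left _)

/-- The mean squared effect of one stochastic gradient step. -/
theorem integral_norm_sq_step_le (hcM : 0 ≤ cM)
    (hmom : ∀ f : L2 d, ∫ ω, (inner ℝ (M.XL ω) f) ^ 4 ∂P
      ≤ cM * (∫ ω, (inner ℝ (M.XL ω) f) ^ 2 ∂P) ^ 2)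
    (B K : L2 d →L[ℝ] L2 d) (η : ℝ) (e : L2 d) :
    Integrable (fun ω => ‖B (M.sqrtCov (e - (η * (inner ℝ (M.XL ω) e - M.noise ω)) •
      K (M.XL ω)))‖ ^ 2) P ∧
    ∫ ω, ‖B (M.sqrtCov (e - (η * (inner ℝ (M.XL ω) e - M.noise ω)) • K (M.XL ω)))‖ ^ 2 ∂P
      ≤ ‖B ((1 - η • M.sqrtCov.comp (K.comp M.sqrtCov)) (M.sqrtCov e))‖ ^ 2
        + η ^ 2 * (cM * ‖M.sqrtCov e‖ ^ 2 + Var[M.noise; P])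
          * ∫ ω, ‖B (M.sqrtCov (K (M.XL ω)))‖ ^ 2 ∂P := by
  set T := B.comp (M.sqrtCov.comp K) with hT
  set w := B (M.sqrtCov e) with hw
  -- The adjoint turns the cross term ⟨w, T X⟩ into the linear functional ⟨X, g⟩, whose product with
  -- the noise has mean zero.
  let g := T.adjoint w
  have hg : ∀ x, inner ℝ w (T x) = inner ℝ x g := fun x => by
    rw [ContinuousLinearMap.adjoint_inner_right, real_inner_comm]
  have hTb : ∀ x : L2 d, ‖x‖ = 1 → ‖T x‖ ≤ ‖T‖ := fun x hx => by simpa [hx] using T.le_opNorm x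
  have mT : Measurable fun x : L2 d => ‖T x‖ ^ 2 := by fun_prop
  have bT : ∀ x : L2 d, ‖x‖ = 1 → |‖T x‖ ^ 2| ≤ ‖T‖ ^ 2 := fun x hx => by
    rw [abs_of_nonneg (sq_nonneg _)]
    exact pow_le_pow_left₀ (norm_nonneg _) (hTb x hx) 2
  have bTe : ∀ (n : ℕ) (x : L2 d), ‖x‖ = 1 →
      |(inner ℝ x e : ℝ) ^ n * ‖T x‖ ^ 2| ≤ ‖e‖ ^ n * ‖T‖ ^ 2 := fun n x hx => by
    rw [abs_mul, abs_pow]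
    gcongr
    · exact abs_inner_le_of_norm_eq_one e hx
    · exact bT x hx
  have mTe : ∀ n : ℕ, Measurable fun x : L2 d => (inner ℝ x e : ℝ) ^ n * ‖T x‖ ^ 2 :=
    fun n => ((measurable_inner_right e).pow_const n).mul mT
  have i1 := (M.integrable_inner_pow_mul_inner_pow e g 1 1).const_mul (-(2 * η))
  have i2 := (M.integrable_noise_mul (measurable_inner_right g)
    fun x hx => abs_inner_le_of_norm_eq_one g hx).const_mul (2 * η)
  have i3 := (M.integrable_comp_XL (mTe 2) (bTe 2)).const_mul (η ^ 2)
  have i4 := (M.integrable_noise_mul (mTe 1) (bTe 1)).const_mul (-(2 * η ^ 2))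
  have i5 := (M.integrable_noise_sq_mul mT bT).const_mul (η ^ 2)
  have hexp : (fun ω => ‖B (M.sqrtCov (e - (η * (inner ℝ (M.XL ω) e - M.noise ω)) •
      K (M.XL ω)))‖ ^ 2) = (fun _ => ‖w‖ ^ 2)
        + (fun ω => (-(2 * η)) * ((inner ℝ (M.XL ω) e : ℝ) ^ 1 * inner ℝ (M.XL ω) g ^ 1))
        + (fun ω => (2 * η) * (inner ℝ (M.XL ω) g * M.noise ω))
        + (fun ω => η ^ 2 * ((inner ℝ (M.XL ω) e : ℝ) ^ 2 * ‖T (M.XL ω)‖ ^ 2))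
        + (fun ω => (-(2 * η ^ 2)) *
          ((inner ℝ (M.XL ω) e : ℝ) ^ 1 * ‖T (M.XL ω)‖ ^ 2 * M.noise ω))
        + fun ω => η ^ 2 * (‖T (M.XL ω)‖ ^ 2 * M.noise ω ^ 2) := by
    ext ω
    have h1 : B (M.sqrtCov (e - (η * (inner ℝ (M.XL ω) e - M.noise ω)) • K (M.XL ω)))
        = w - (η * (inner ℝ (M.XL ω) e - M.noise ω)) • T (M.XL ω) := by
      simp [hw, hT]
    rw [h1, norm_sub_sq_real, inner_smul_right, hg, norm_smul, mul_pow, Real.norm_eq_abs, sq_abs]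
    simp only [Pi.add_apply]
    ring
  have j0 : Integrable (fun _ : Ω => ‖w‖ ^ 2) P := integrable_const _
  rw [hexp]
  refine ⟨((((j0.add i1).add i2).add i3).add i4).add i5, ?_⟩
  rw [integral_add' ((((j0.add i1).add i2).add i3).add i4) i5,
    integral_add' (((j0.add i1).add i2).add i3) i4, integral_add' ((j0.add i1).add i2) i3,
    integral_add' (j0.add i1) i2, integral_add' j0 i1]
  simp only [integral_const_mul]
  rw [M.integral_noise_mul (measurable_inner_right g)
      fun x hx => abs_inner_le_of_norm_eq_one g hx,
    M.integral_noise_mul (mTe 1) (bTe 1), M.integral_noise_sq_mul mT bT]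
  have h2 : ∫ ω, (inner ℝ (M.XL ω) e : ℝ) ^ 1 * inner ℝ (M.XL ω) g ^ 1 ∂P
      = inner ℝ w (B (M.sqrtCov (K (M.sqrtCov (M.sqrtCov e))))) := by
    simp only [pow_one]
    rw [← M.inner_integralOp_C, ← hg, M.sqrtCov_sqrtCov]
    rfl
  have h3 : ‖B ((1 - η • M.sqrtCov.comp (K.comp M.sqrtCov)) (M.sqrtCov e))‖ ^ 2
      = ‖w‖ ^ 2 - 2 * η * inner ℝ w (B (M.sqrtCov (K (M.sqrtCov (M.sqrtCov e)))))
        + η ^ 2 * ‖B (M.sqrtCov (K (M.sqrtCov (M.sqrtCov e))))‖ ^ 2 := by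
    have h4 : B ((1 - η • M.sqrtCov.comp (K.comp M.sqrtCov)) (M.sqrtCov e))
        = w - η • B (M.sqrtCov (K (M.sqrtCov (M.sqrtCov e)))) := by
      simp [hw]
    rw [h4, norm_sub_sq_real, inner_smul_right, norm_smul, mul_pow, Real.norm_eq_abs, sq_abs]
    ring
  have h5 := mul_le_mul_of_nonneg_left (integral_inner_sq_mul_norm_sq_le hcM hmom e T)
    (sq_nonneg η)
  -- Completing the square in `h3` introduces this term, which is nonnegative and only enlarges the
  -- right-hand side.
  have h6 : 0 ≤ η ^ 2 * ‖B (M.sqrtCov (K (M.sqrtCov (M.sqrtCov e))))‖ ^ 2 := by positivity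
  have h7 : ∀ ω, ‖B (M.sqrtCov (K (M.XL ω)))‖ ^ 2 = ‖T (M.XL ω)‖ ^ 2 := fun ω => rfl
  simp only [h7]
  rw [h2, h3, integral_const, probReal_univ, one_smul]
  linarith

/-- The excess error of a linear functional. -/
theorem excessError_inner (β : L2 d) :
    M.excessError (fun f => inner ℝ β f) = ‖M.sqrtCov (β - M.betaStar)‖ ^ 2 := by
  set g := M.betaStar - β with hg
  have h1 : ∀ ω, (M.Y ω - inner ℝ β (M.XL ω)) ^ 2 - (M.Y ω - inner ℝ M.betaStar (M.XL ω)) ^ 2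
      = inner ℝ (M.XL ω) g ^ 2 + 2 * (inner ℝ (M.XL ω) g * M.noise ω) := by
    intro ω
    rw [hg, inner_sub_right, real_inner_comm β, real_inner_comm M.betaStar, Y]
    ring
  have hn := M.integrable_noise_mul (measurable_inner_right g)
    fun x hx => abs_inner_le_of_norm_eq_one g hx
  rw [← neg_sub, ← hg, map_neg, norm_neg, M.norm_sqrtCov_sq, excessError]
  simp only [h1]
  rw [integral_add (M.integrable_inner_pow g 2) (hn.const_mul 2), integral_const_mul,
    M.integral_noise_mul (measurable_inner_right g)
      fun x hx => abs_inner_le_of_norm_eq_one g hx]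
  simp

end FLModel

/-! ### Independence of past and next observation, and the risk recursion. -/

/-- Integrating out the second of two independent random variables. -/
theorem _root_.ProbabilityTheory.IndepFun.integrable_and_integral_le {Ω' α β : Type*}
    [MeasurableSpace Ω'] [MeasurableSpace α] [MeasurableSpace β] {Q : Measure Ω'}
    [IsProbabilityMeasure Q] {U : Ω' → α} {V : Ω' → β} (hUV : IndepFun U V Q)
    (hU : AEMeasurable U Q) (hV : AEMeasurable V Q) {G : α × β → ℝ} (hG : Measurable G)
    (hG0 : ∀ z, 0 ≤ G z) {h : α → ℝ} (hh : Measurable h)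
    (hint : Integrable (fun ω' => h (U ω')) Q)
    (hle : ∀ a, Integrable (fun b => G (a, b)) (Q.map V) ∧ ∫ b, G (a, b) ∂(Q.map V) ≤ h a) :
    Integrable (fun ω' => G (U ω', V ω')) Q ∧ ∫ ω', G (U ω', V ω') ∂Q ≤ ∫ ω', h (U ω') ∂Q := by
  have : IsProbabilityMeasure (Q.map U) := Measure.isProbabilityMeasure_map hU
  have : IsProbabilityMeasure (Q.map V) := Measure.isProbabilityMeasure_map hV
  have hmap := (indepFun_iff_map_prod_eq_prod_map_map hU hV).1 hUV
  have hUVm : AEMeasurable (fun ω' => (U ω', V ω')) Q := hU.prodMk hV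
  have hh' : Integrable h (Q.map U) :=
    (integrable_map_measure hh.aestronglyMeasurable hU).2 hint
  have hGi : Integrable G ((Q.map U).prod (Q.map V)) := by
    refine (integrable_prod_iff hG.aestronglyMeasurable).2
      ⟨Filter.Eventually.of_forall fun a => (hle a).1, ?_⟩
    refine hh'.mono' hG.aestronglyMeasurable.norm.integral_prod_right'
      (Filter.Eventually.of_forall fun a => ?_)
    simp only [Real.norm_of_nonneg (hG0 _)]
    rw [Real.norm_of_nonneg (integral_nonneg fun b => hG0 _)]
    exact (hle a).2
  refine ⟨(integrable_map_measure hG.aestronglyMeasurable hUVm).1 (hmap ▸ hGi), ?_⟩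
  rw [← integral_map hUVm hG.aestronglyMeasurable, hmap, integral_prod _ hGi,
    ← integral_map hU hh.aestronglyMeasurable]
  exact integral_mono hGi.integral_prod_left hh' fun a => (hle a).2

variable {d : ℕ}

theorem sgd_congr (K : C(Cube d × Cube d, ℝ)) (η : ℕ → ℝ) {x x' : ℕ → L2 d} {y y' : ℕ → ℝ}
    {n : ℕ} (hx : ∀ t ∈ Finset.Icc 1 n, x t = x' t) (hy : ∀ t ∈ Finset.Icc 1 n, y t = y' t) :
    sgd K η x y n = sgd K η x' y' n := by
  induction n with
  | zero => rfl
  | succ n ih =>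
    have hmem : n + 1 ∈ Finset.Icc 1 (n + 1) := by simp
    have hsub : Finset.Icc 1 n ⊆ Finset.Icc 1 (n + 1) := Finset.Icc_subset_Icc_right n.le_succ
    rw [sgd, sgd, ih (fun t ht => hx t (hsub ht)) (fun t ht => hy t (hsub ht)), hx _ hmem,
      hy _ hmem]

theorem measurable_sgd (K : C(Cube d × Cube d, ℝ)) (η : ℕ → ℝ) {α : Type*} [MeasurableSpace α]
    {x : ℕ → α → L2 d} {y : ℕ → α → ℝ} (hx : ∀ t, Measurable (x t)) (hy : ∀ t, Measurable (y t))
    (n : ℕ) : Measurable fun a => sgd K η (fun t => x t a) (fun t => y t a) n := by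
  induction n with
  | zero => exact measurable_const
  | succ n ih =>
    have h1 : Measurable fun a =>
        (inner ℝ (sgd K η (fun t => x t a) (fun t => y t a) n) (x (n + 1) a) : ℝ) :=
      ih.inner (hx _)
    exact ih.sub (((h1.sub (hy _)).const_mul _).smul
      ((integralOp K).continuous.measurable.comp (hx _)))

namespace FLModel

variable {Ω : Type*} [MeasurableSpace Ω] {P : Measure Ω} {M : FLModel d P}
  {Ω' : Type*} [MeasurableSpace Ω'] {Q : Measure Ω'}
  {T : ℕ} {x : ℕ → Ω' → L2 d} {y : ℕ → Ω' → ℝ}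

/-- The estimator after `n` steps is independent of the next observation. -/
theorem IsSample.indepFun_sgd (hS : M.IsSample Q T x y) (K : C(Cube d × Cube d, ℝ)) (η : ℕ → ℝ)
    {n : ℕ} (hn : n < T) :
    AEMeasurable (fun ω' => sgd K η (fun t => x t ω') (fun t => y t ω') n) Q ∧
    IndepFun (fun ω' => sgd K η (fun t => x t ω') (fun t => y t ω') n)
      (fun ω' => (x (n + 1) ω', y (n + 1) ω')) Q := by
  classical
  have hmeas : ∀ t : Finset.Icc 1 T, AEMeasurable (fun ω' => (x t ω', y t ω')) Q :=
    fun t => (hS.identDistrib t t.2).aemeasurable_fst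
  let next : Finset.Icc 1 T := ⟨n + 1, Finset.mem_Icc.2 ⟨by omega, hn⟩⟩
  let past : Finset (Finset.Icc 1 T) := Finset.univ.filter fun t => (t : ℕ) ≤ n
  have hdisj : Disjoint past {next} := by
    rw [Finset.disjoint_singleton_right]
    simp [past, next]
  have hind := hS.indep.indepFun_finset₀ past {next} hdisj hmeas
  have hpast : ∀ t, t ∈ Finset.Icc 1 n → ∃ ht : t ∈ Finset.Icc 1 T, ⟨t, ht⟩ ∈ past := by
    intro t ht
    rw [Finset.mem_Icc] at ht
    exact ⟨Finset.mem_Icc.2 ⟨ht.1, by omega⟩, by simp [past, ht.2]⟩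
  -- The default 0 outside the past is harmless: by `sgd_congr` the first n steps read only
  -- observations 1 to n.
  let obs : ℕ → (past → L2 d × ℝ) → L2 d × ℝ := fun t z =>
    if h : ∃ ht : t ∈ Finset.Icc 1 T, ⟨t, ht⟩ ∈ past then z ⟨⟨t, h.1⟩, h.2⟩ else 0
  have hobs : ∀ t, Measurable (obs t) := by
    intro t
    by_cases h : ∃ ht : t ∈ Finset.Icc 1 T, ⟨t, ht⟩ ∈ past
    · simp only [obs, dif_pos h]
      exact measurable_pi_apply _
    · simp only [obs, dif_neg h]
      exact measurable_const
  let Φ : (past → L2 d × ℝ) → L2 d := fun z =>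
    sgd K η (fun t => (obs t z).1) (fun t => (obs t z).2) n
  have hΦ : Measurable Φ :=
    measurable_sgd K η (fun t => (hobs t).fst) (fun t => (hobs t).snd) n
  have hsgd : (fun ω' => sgd K η (fun t => x t ω') (fun t => y t ω') n)
      = Φ ∘ fun ω' (t : past) => (x t ω', y t ω') := by
    ext1 ω'
    refine sgd_congr K η (fun t ht => ?_) fun t ht => ?_
    · simp only [obs, dif_pos (hpast t ht)]
    · simp only [obs, dif_pos (hpast t ht)]
  have htuple : AEMeasurable (fun ω' (t : past) => (x t ω', y t ω')) Q :=
    aemeasurable_pi_lambda _ fun t => hmeas t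
  rw [hsgd]
  refine ⟨hΦ.comp_aemeasurable htuple, ?_⟩
  exact hind.comp hΦ (measurable_pi_apply (⟨next, Finset.mem_singleton_self _⟩ :
    ({next} : Finset (Finset.Icc 1 T))))

variable [IsProbabilityMeasure P] [IsProbabilityMeasure Q] {cM : ℝ}

/-- The one-step estimate holds for each fixed value of the past, and independence integrates it. B
is left arbitrary so that powers of 1 - η 𝓛_K can be absorbed into it. -/
theorem IsSample.integral_norm_sq_succ_le (hS : M.IsSample Q T x y) (hcM : 0 ≤ cM)
    (hmom : ∀ f : L2 d, ∫ ω, (inner ℝ (M.XL ω) f) ^ 4 ∂P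
      ≤ cM * (∫ ω, (inner ℝ (M.XL ω) f) ^ 2 ∂P) ^ 2)
    (K : C(Cube d × Cube d, ℝ)) (η : ℝ) {n : ℕ} (hn : n < T) {β : ℕ → Ω' → L2 d}
    (hβ : ∀ n ω', β n ω' = sgd K (fun _ => η) (fun t => x t ω') (fun t => y t ω') n)
    (hint : Integrable (fun ω' => ‖M.sqrtCov (β n ω' - M.betaStar)‖ ^ 2) Q)
    (B : L2 d →L[ℝ] L2 d) :
    Integrable (fun ω' => ‖B (M.sqrtCov (β (n + 1) ω' - M.betaStar))‖ ^ 2) Q ∧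
    ∫ ω', ‖B (M.sqrtCov (β (n + 1) ω' - M.betaStar))‖ ^ 2 ∂Q
      ≤ ∫ ω', ‖B ((1 - η • scrL M.C K) (M.sqrtCov (β n ω' - M.betaStar)))‖ ^ 2 ∂Q
        + η ^ 2 * (cM * ∫ ω', ‖M.sqrtCov (β n ω' - M.betaStar)‖ ^ 2 ∂Q + Var[M.noise; P])
          * ∫ ω, ‖B (M.sqrtCov (integralOp K (M.XL ω)))‖ ^ 2 ∂P := by
  obtain ⟨hU, hUV⟩ := hS.indepFun_sgd K (fun _ => η) hn
  have hβn : (fun ω' => sgd K (fun _ => η) (fun t => x t ω') (fun t => y t ω') n) = β n :=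
    funext fun ω' => (hβ n ω').symm
  rw [hβn] at hU hUV
  have hid := hS.identDistrib (n + 1) (Finset.mem_Icc.2 ⟨by omega, hn⟩)
  set Z := 1 - η • scrL M.C K with hZ
  set w := ∫ ω, ‖B (M.sqrtCov (integralOp K (M.XL ω)))‖ ^ 2 ∂P
  let G : L2 d × (L2 d × ℝ) → ℝ := fun p =>
    ‖B (M.sqrtCov (p.1 - (η * (inner ℝ p.1 p.2.1 - p.2.2)) • integralOp K p.2.1
      - M.betaStar))‖ ^ 2
  have hG : Measurable G := by
    have : Continuous G := by fun_prop
    exact this.measurable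
  have j1 : Integrable (fun ω' => ‖B (Z (M.sqrtCov (β n ω' - M.betaStar)))‖ ^ 2) Q := by
    refine (hint.const_mul (‖B.comp Z‖ ^ 2)).mono' ?_ (Filter.Eventually.of_forall fun ω' => ?_)
    · have hc : Continuous fun b => ‖B (Z (M.sqrtCov (b - M.betaStar)))‖ ^ 2 := by fun_prop
      exact (hc.measurable.comp_aemeasurable hU).aestronglyMeasurable
    · rw [Real.norm_of_nonneg (sq_nonneg _), ← mul_pow]
      exact pow_le_pow_left₀ (norm_nonneg _) ((B.comp Z).le_opNorm _) 2
  have j2 : Integrable (fun ω' => η ^ 2 * (cM * ‖M.sqrtCov (β n ω' - M.betaStar)‖ ^ 2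
      + Var[M.noise; P]) * w) Q := (((hint.const_mul cM).add (integrable_const Var[M.noise; P])).const_mul
    (η ^ 2)).mul_const w
  have hmain := hUV.integrable_and_integral_le hU hid.aemeasurable_fst hG (fun p => sq_nonneg _)
    (h := fun b => ‖B (Z (M.sqrtCov (b - M.betaStar)))‖ ^ 2
      + η ^ 2 * (cM * ‖M.sqrtCov (b - M.betaStar)‖ ^ 2 + Var[M.noise; P]) * w)
    (Continuous.measurable (by fun_prop)) (j1.add j2) fun b => ?_
  · have hnext : ∀ ω', β (n + 1) ω' = β n ω' - (η * (inner ℝ (β n ω') (x (n + 1) ω')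
        - y (n + 1) ω')) • integralOp K (x (n + 1) ω') := fun ω' => by
      rw [hβ, hβ, sgd]
    simp only [hnext]
    refine ⟨hmain.1, hmain.2.trans_eq ?_⟩
    rw [integral_add j1 j2, integral_mul_const, integral_const_mul,
      integral_add (hint.const_mul cM) (integrable_const _), integral_const_mul]
    simp
  · obtain ⟨h1, h2⟩ := integral_norm_sq_step_le hcM hmom B (integralOp K) η (b - M.betaStar)
    have hstep : ∀ ω, G (b, (M.XL ω, M.Y ω)) = ‖B (M.sqrtCov (b - M.betaStar
        - (η * (inner ℝ (M.XL ω) (b - M.betaStar) - M.noise ω)) •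
          integralOp K (M.XL ω)))‖ ^ 2 := fun ω => by
      -- The residual depends on b only through the error b - β*, up to the noise.
      have : (inner ℝ b (M.XL ω) : ℝ) - M.Y ω
          = inner ℝ (M.XL ω) (b - M.betaStar) - M.noise ω := by
        rw [Y, inner_sub_right, real_inner_comm b, real_inner_comm M.betaStar]
        ring
      simp only [G, this]
      rw [sub_right_comm]
    have hGb : Measurable fun p => G (b, p) := hG.comp measurable_prodMk_left
    rw [hid.map_eq, integral_map hid.aemeasurable_snd hGb.aestronglyMeasurable,
      integrable_map_measure hGb.aestronglyMeasurable hid.aemeasurable_snd]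
    simp only [hstep, Function.comp_def]
    exact ⟨h1, h2⟩

/-- Each step back in time moves one factor 1 - η 𝓛_K from the iterate into B, so the induction
hypothesis is used at B ∘ (1 - η 𝓛_K). The noise added at each step is damped by the later factors.
-/
theorem IsSample.integral_norm_sq_le (hS : M.IsSample Q T x y) (hcM : 0 ≤ cM)
    (hmom : ∀ f : L2 d, ∫ ω, (inner ℝ (M.XL ω) f) ^ 4 ∂P
      ≤ cM * (∫ ω, (inner ℝ (M.XL ω) f) ^ 2 ∂P) ^ 2)
    (K : C(Cube d × Cube d, ℝ)) (η : ℝ) {β : ℕ → Ω' → L2 d}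
    (hβ : ∀ n ω', β n ω' = sgd K (fun _ => η) (fun t => x t ω') (fun t => y t ω') n)
    {D : ℝ} {n : ℕ} (hn : n ≤ T)
    (hD : ∀ m < n, Integrable (fun ω' => ‖M.sqrtCov (β m ω' - M.betaStar)‖ ^ 2) Q ∧
      ∫ ω', ‖M.sqrtCov (β m ω' - M.betaStar)‖ ^ 2 ∂Q ≤ D)
    (B : L2 d →L[ℝ] L2 d) :
    Integrable (fun ω' => ‖B (M.sqrtCov (β n ω' - M.betaStar))‖ ^ 2) Q ∧
    ∫ ω', ‖B (M.sqrtCov (β n ω' - M.betaStar))‖ ^ 2 ∂Q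
      ≤ ‖B (((1 - η • scrL M.C K) ^ n) (M.sqrtCov M.betaStar))‖ ^ 2
        + η ^ 2 * (cM * D + Var[M.noise; P]) * ∑ j ∈ Finset.range n,
          ∫ ω, ‖B (((1 - η • scrL M.C K) ^ j) (M.sqrtCov (integralOp K (M.XL ω))))‖ ^ 2 ∂P := by
  induction n generalizing B with
  | zero =>
    have h0 : ∀ ω', β 0 ω' = 0 := fun ω' => hβ 0 ω'
    simp [h0]
  | succ n ih =>
    obtain ⟨hi, hle⟩ := hD n n.lt_succ_self
    obtain ⟨h1, h2⟩ := hS.integral_norm_sq_succ_le hcM hmom K η hn hβ hi B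
    refine ⟨h1, h2.trans ?_⟩
    obtain ⟨-, h3⟩ := ih (by omega) (fun m hm => hD m (by omega)) (B.comp (1 - η • scrL M.C K))
    have h4 : η ^ 2 * (cM * ∫ ω', ‖M.sqrtCov (β n ω' - M.betaStar)‖ ^ 2 ∂Q + Var[M.noise; P])
          * ∫ ω, ‖B (M.sqrtCov (integralOp K (M.XL ω)))‖ ^ 2 ∂P
        ≤ η ^ 2 * (cM * D + Var[M.noise; P])
          * ∫ ω, ‖B (M.sqrtCov (integralOp K (M.XL ω)))‖ ^ 2 ∂P := by
      refine mul_le_mul_of_nonneg_right ?_ (integral_nonneg fun ω => sq_nonneg _)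
      gcongr
    have h5 : ∀ (k : ℕ) (f : L2 d), ((1 - η • scrL M.C K) ^ (k + 1)) f
        = (1 - η • scrL M.C K) (((1 - η • scrL M.C K) ^ k) f) := fun k f => by
      rw [pow_succ', mul_apply_eq_comp]
    refine (add_le_add h3 h4).trans_eq ?_
    rw [Finset.sum_range_succ', mul_add (η ^ 2 * (cM * D + Var[M.noise; P])), ← add_assoc]
    simp only [h5, pow_zero, one_apply_eq_self]
    rfl

/-- The accumulated noise level of the gradient iteration. -/
theorem mul_sum_integral_norm_sq_le {K : C(Cube d × Cube d, ℝ)} (hK : IsReproducingKernel K)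
    {η : ℝ} (hη : 0 ≤ η) (hη1 : η * kappa K ^ 2 ≤ 1) (n : ℕ) :
    η * ∑ j ∈ Finset.range n,
      ∫ ω, ‖((1 - η • scrL M.C K) ^ j) (M.sqrtCov (integralOp K (M.XL ω)))‖ ^ 2 ∂P
      ≤ kappa K ^ 2 := by
  have hi : ∀ j : ℕ, Integrable (fun ω =>
      ‖((1 - η • scrL M.C K) ^ j) (M.sqrtCov (integralOp K (M.XL ω)))‖ ^ 2) P := fun j =>
    M.integrable_norm_sq (((1 - η • scrL M.C K) ^ j).comp (M.sqrtCov.comp (integralOp K)))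
  rw [← integral_finsetSum _ fun j _ => hi j, ← integral_const_mul]
  have h : ∀ᵐ ω ∂P, η * ∑ j ∈ Finset.range n,
      ‖((1 - η • scrL M.C K) ^ j) (M.sqrtCov (integralOp K (M.XL ω)))‖ ^ 2 ≤ kappa K ^ 2 := by
    filter_upwards [M.norm_XL] with ω hω
    refine (sum_norm_sq_one_sub_pow_le M.sqrtCov_isSymmetric (integralOp_isSymmetric hK.symm)
      hK.inner_integralOp_nonneg hη (M.mul_inner_scrL_le hK hη hη1) n (M.XL ω)).trans ?_
    simpa [hω] using hK.inner_integralOp_le (M.XL ω)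
  have := integral_mono_of_nonneg (Filter.Eventually.of_forall fun ω => by positivity)
    (integrable_const (kappa K ^ 2)) h
  simpa using this

/-- The risk of the iterates stays bounded, and is at most squared bias plus variance. -/
theorem IsSample.integral_norm_sq_sub_le (hS : M.IsSample Q T x y) (hcM : 0 ≤ cM)
    (hmom : ∀ f : L2 d, ∫ ω, (inner ℝ (M.XL ω) f) ^ 4 ∂P
      ≤ cM * (∫ ω, (inner ℝ (M.XL ω) f) ^ 2 ∂P) ^ 2)
    {K : C(Cube d × Cube d, ℝ)} (hK : IsReproducingKernel K) {η : ℝ} (hη : 0 ≤ η)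
    (hη1 : η * kappa K ^ 2 ≤ 1) (hη2 : η * kappa K ^ 2 * cM ≤ 1 / 2) {β : ℕ → Ω' → L2 d}
    (hβ : ∀ n ω', β n ω' = sgd K (fun _ => η) (fun t => x t ω') (fun t => y t ω') n)
    {n : ℕ} (hn : n ≤ T) :
    Integrable (fun ω' => ‖M.sqrtCov (β n ω' - M.betaStar)‖ ^ 2) Q ∧
    ∫ ω', ‖M.sqrtCov (β n ω' - M.betaStar)‖ ^ 2 ∂Q
      ≤ ‖((1 - η • scrL M.C K) ^ n) (M.sqrtCov M.betaStar)‖ ^ 2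
        + η * kappa K ^ 2 * (cM * (2 * (‖M.betaStar‖ ^ 2 + Var[M.noise; P]))
          + Var[M.noise; P]) := by
  have hv : 0 ≤ Var[M.noise; P] := variance_nonneg _ _
  -- D solves ‖β*‖² + σ² + D/2 = D; since η κ² cM ≤ 1/2 and η κ² ≤ 1, the bound reproduces itself in
  -- the strong induction below.
  set D := 2 * (‖M.betaStar‖ ^ 2 + Var[M.noise; P]) with hDdef
  have hD0 : 0 ≤ D := by positivity
  have hstep : ∀ n ≤ T, (∀ m < n, Integrable (fun ω' => ‖M.sqrtCov (β m ω' - M.betaStar)‖ ^ 2) Q ∧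
      ∫ ω', ‖M.sqrtCov (β m ω' - M.betaStar)‖ ^ 2 ∂Q ≤ D) →
      Integrable (fun ω' => ‖M.sqrtCov (β n ω' - M.betaStar)‖ ^ 2) Q ∧
      ∫ ω', ‖M.sqrtCov (β n ω' - M.betaStar)‖ ^ 2 ∂Q
        ≤ ‖((1 - η • scrL M.C K) ^ n) (M.sqrtCov M.betaStar)‖ ^ 2
          + η * kappa K ^ 2 * (cM * D + Var[M.noise; P]) := by
    intro n hn hm
    obtain ⟨h1, h2⟩ := hS.integral_norm_sq_le hcM hmom K η hβ hn hm 1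
    simp only [one_apply_eq_self] at h1 h2
    refine ⟨h1, h2.trans ?_⟩
    -- One factor η of η² pays for the whole sum; the other remains as the order of the variance.
    have h3 := mul_le_mul_of_nonneg_left (mul_sum_integral_norm_sq_le (M := M) hK hη hη1 n)
      (mul_nonneg hη (by positivity : 0 ≤ cM * D + Var[M.noise; P]))
    nlinarith
  have hcontr : ∀ n : ℕ, ‖((1 - η • scrL M.C K) ^ n) (M.sqrtCov M.betaStar)‖ ≤ ‖M.betaStar‖ := by
    intro n
    induction n with
    | zero => simpa using M.norm_sqrtCov_le M.betaStar
    | succ n ih =>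
      rw [pow_succ', mul_apply_eq_comp]
      exact (norm_one_sub_smul_apply_le (M.scrL_isSymmetric hK) (M.inner_scrL_nonneg hK) hη
        (M.mul_inner_scrL_le hK hη hη1) _).trans ih
  have hbound : ∀ n ≤ T, Integrable (fun ω' => ‖M.sqrtCov (β n ω' - M.betaStar)‖ ^ 2) Q ∧
      ∫ ω', ‖M.sqrtCov (β n ω' - M.betaStar)‖ ^ 2 ∂Q ≤ D := by
    intro n
    induction n using Nat.strong_induction_on with
    | _ n ih =>
      intro hn
      obtain ⟨h1, h2⟩ := hstep n hn fun m hm => ih m hm (hm.le.trans hn)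
      refine ⟨h1, h2.trans ?_⟩
      have h3 := pow_le_pow_left₀ (norm_nonneg _) (hcontr n) 2
      have h4 := mul_le_mul_of_nonneg_right hη2 hD0
      have h5 := mul_le_mul_of_nonneg_right hη1 hv
      nlinarith
  exact hstep n hn fun m hm => hbound m (hm.le.trans hn)

end FLModel

/-- The squared bias factor for the step size `η₀ T ^ (-2r/(2r+1))`. -/
theorem sq_rpow_div_step_mul_le {r η₀ : ℝ} (hr : 0 < r) (hη₀ : 0 < η₀) {T : ℕ} (hT : 1 ≤ T) :
    ((r / (η₀ * (T : ℝ) ^ (-(2 * r / (2 * r + 1))) * T)) ^ r) ^ 2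
      = (r / η₀) ^ (2 * r) * (T : ℝ) ^ (-(2 * r / (2 * r + 1))) := by
  have hT0 : (0 : ℝ) < T := by exact_mod_cast hT
  -- The total step length ηT grows like T^{1/(2r+1)}; its power -2r is the rate.
  have h1 : η₀ * (T : ℝ) ^ (-(2 * r / (2 * r + 1))) * T = η₀ * (T : ℝ) ^ (1 / (2 * r + 1)) := by
    rw [mul_assoc, ← Real.rpow_add_one hT0.ne']
    congr 2
    field_simp
    ring
  rw [h1, ← div_div, ← Real.rpow_natCast, ← Real.rpow_mul (by positivity),
    Real.div_rpow (by positivity) (by positivity), ← Real.rpow_mul hT0.le, Real.rpow_neg hT0.le,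
    div_eq_mul_inv]
  congr 2
  · push_cast
    ring_nf
  · congr 1
    push_cast
    field_simp

end FunctionalSGD

/-! ### Choice of constants and conclusion. -/

open FunctionalSGD in
theorem theorem2
    -- the exponents of the regularity and capacity conditions, and the values of
    -- `κ`, of the moment constant and of `Tr(𝓛_K^s)`
    (r s κ cM τ : ℝ) (hr : 0 < r) (hs : 0 < s) (hs1 : s ≤ 1) :
    ∃ CS : ℝ, 0 < CS ∧
      ∀ η₀ : ℝ, 0 < η₀ → η₀ ≤ min 1 (min (κ ^ 2)⁻¹ CS) →
      -- the values of `‖β*‖`, of `‖g*‖` and of the noise variance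
      ∀ B G v : ℝ, ∃ C₂ : ℝ,
        ∀ (d : ℕ) {Ω : Type*} [MeasurableSpace Ω] (P : Measure Ω) [IsProbabilityMeasure P]
          (M : FLModel d P) (K : C(Cube d × Cube d, ℝ)), IsReproducingKernel K → K ≠ 0 →
          kappa K = κ → ‖M.betaStar‖ = B → Var[M.noise; P] = v →
          -- regularity condition
          (∃ gStar : L2 d, ‖gStar‖ = G ∧
            opPow (integralOp M.C) (1 / 2) M.betaStar = opPow (scrL M.C K) r gStar) →
          -- capacity condition
          opTrace (opPow (scrL M.C K) s) = ENNReal.ofReal τ →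
          -- moment condition
          (0 < cM ∧ ∀ f : L2 d,
            ∫ ω, (inner ℝ (M.XL ω) f) ^ 4 ∂P ≤ cM * (∫ ω, (inner ℝ (M.XL ω) f) ^ 2 ∂P) ^ 2) →
          ∀ (T : ℕ), 1 ≤ T →
          ∀ {Ω' : Type*} [MeasurableSpace Ω'] (Q : Measure Ω') [IsProbabilityMeasure Q]
            (x : ℕ → Ω' → L2 d) (y : ℕ → Ω' → ℝ), M.IsSample Q T x y →
          let η : ℕ → ℝ := fun _ => η₀ * (T : ℝ) ^ (-(2 * r / (2 * r + 1)))
          let err : Ω' → ℝ := fun ω' =>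
            M.excessError (fun f => inner ℝ (sgd K η (fun t => x t ω') (fun t => y t ω') T) f)
          Integrable err Q ∧
            ∫ ω', err ω' ∂Q ≤ C₂ * ((T : ℝ) ^ (-(2 * r / (2 * r + 1))) *
              (if s < 1 then 1 else Real.log ((T : ℝ) + 1))) := by
  -- This choice forces η₀ κ² cM ≤ 1/2. The absolute value is there because cM > 0 is not yet
  -- available when the constant is fixed.
  refine ⟨1 / (2 * (κ ^ 2 * |cM| + 1)), by positivity, fun η₀ hη₀ hη₀le B G v => ?_⟩
  rw [le_min_iff, le_min_iff] at hη₀le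
  obtain ⟨-, hη₀κ, hη₀C⟩ := hη₀le
  -- For κ = 0 the convention 0⁻¹ = 0 would leave no admissible η₀.
  have hκ : 0 < κ ^ 2 := by
    by_contra! h
    exact absurd (hη₀.trans_le hη₀κ) (not_lt.2 (inv_nonpos.2 h))
  have hη₀1 : η₀ * κ ^ 2 ≤ 1 := by
    rwa [← le_div_iff₀ hκ, one_div]
  have hη₀2 : η₀ * κ ^ 2 * |cM| ≤ 1 / 2 := by
    rw [le_div_iff₀ (by positivity)] at hη₀C
    nlinarith
  have hlog2 : 0 < Real.log 2 := Real.log_pos one_lt_two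
  -- Squared bias plus variance, with the common factor T^{-2r/(2r+1)} removed.
  set C := (r / η₀) ^ (2 * r) * G ^ 2 + η₀ * κ ^ 2 * (cM * (2 * (B ^ 2 + v)) + v) with hC
  refine ⟨C / Real.log 2, ?_⟩
  intro d Ω _ P _ M K hK _ hκK hB hv ⟨g, hgG, hg⟩ _ ⟨hcM, hmom⟩ T hT Ω' _ Q _ x y hS η err
  have hT1 : (1 : ℝ) ≤ T := by exact_mod_cast hT
  set ρ := (T : ℝ) ^ (-(2 * r / (2 * r + 1))) with hρ
  have hρ0 : 0 < ρ := by positivity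
  have hρ1 : ρ ≤ 1 := Real.rpow_le_one_of_one_le_of_nonpos hT1 (by
    rw [neg_nonpos]
    positivity)
  rw [abs_of_pos hcM] at hη₀2
  have hv0 : 0 ≤ v := hv ▸ variance_nonneg _ _
  have hC0 : 0 ≤ C := by positivity
  have hη0 : 0 < η₀ * ρ := by positivity
  have hηκ : η₀ * ρ * κ ^ 2 ≤ η₀ * κ ^ 2 := by
    have := mul_le_mul_of_nonneg_left hρ1 (mul_nonneg hη₀.le hκ.le)
    nlinarith
  have hη1 : η₀ * ρ * kappa K ^ 2 ≤ 1 := by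
    rw [hκK]
    exact hηκ.trans hη₀1
  have hη2 : η₀ * ρ * kappa K ^ 2 * cM ≤ 1 / 2 := by
    rw [hκK]
    exact (mul_le_mul_of_nonneg_right hηκ hcM.le).trans hη₀2
  obtain ⟨h1, h2⟩ := hS.integral_norm_sq_sub_le hcM.le hmom hK hη0.le hη1 hη2
    (fun n ω' => rfl) (le_refl T)
  have herr : err = fun ω' => ‖M.sqrtCov (sgd K η (fun t => x t ω') (fun t => y t ω') T
      - M.betaStar)‖ ^ 2 := funext fun ω' => FLModel.excessError_inner _
  have hbias : ‖((1 - (η₀ * ρ) • scrL M.C K) ^ T) (M.sqrtCov M.betaStar)‖ ^ 2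
      ≤ (r / η₀) ^ (2 * r) * ρ * G ^ 2 := by
    have hnorm : η₀ * ρ * ‖scrL M.C K‖ ≤ 1 :=
      (mul_le_mul_of_nonneg_left (M.norm_scrL_le hK) hη0.le).trans hη1
    have h3 := norm_one_sub_pow_opPow_le (M.scrL_isSymmetric hK) hr hη0 hnorm hT g
    rw [hgG] at h3
    have h4 : M.sqrtCov M.betaStar = opPow (scrL M.C K) r g := hg
    rw [h4, ← sq_rpow_div_step_mul_le hr hη₀ hT, ← mul_pow]
    exact pow_le_pow_left₀ (norm_nonneg _) h3 2
  have hle : ∫ ω', err ω' ∂Q ≤ C * ρ := by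
    rw [herr]
    refine (h2.trans (add_le_add_left hbias _)).trans_eq ?_
    rw [hκK, hB, hv, hC]
    ring
  refine ⟨herr ▸ h1, hle.trans ?_⟩
  -- Both values of the last factor are at least log 2, so dividing C by log 2 serves both cases.
  have hfac : Real.log 2 ≤ if s < 1 then 1 else Real.log ((T : ℝ) + 1) := by
    split_ifs
    · exact (Real.log_two_lt_d9.trans (by norm_num)).le
    · exact Real.log_le_log two_pos (by linarith)
  calc C * ρ = C / Real.log 2 * (ρ * Real.log 2) := by field_simp
    _ ≤ _ := by gcongr
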